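/- Let $N\ge 1$, let $d_1,\dots,d_{N+1}$ be strictly positive integers with sum $n$, put $d_0=d_{N+1}$, and let $0\le r\le n$. Indices $i$ run through $\mathbb Z/(N+1)\mathbb Z$, and schemes over $\mathbb A^1_t=\operatorname{Spec}\mathbb Z[t]$ are described by their functors of points on commutative $\mathbb Z[t]$-algebras $R$. Let $T=\begin{pmatrix}0&\mathrm{Id}_{n-1}\\ t&0\end{pmatrix}\in\mathfrak{gl}_n(\mathbb Z[t])$ and, for $0\le i\le N+1$, $\mathcal V_i=T^{d_1+\cdots+d_i}\mathbb Z[t]^n$. For $1\le i\le N$ let $\alpha_i:\mathcal V_i\to\mathcal V_{i-1}$ be the inclusion, and let $\alpha_0:\mathcal V_0\to\mathcal V_N$ be the composite of the isomorphism $\mathcal V_0\cong\mathcal V_{N+1}=t\mathcal V_0$, $v\mapsto tv$, with the inclusion $\mathcal V_{N+1}\subset\mathcal V_N$. Let $\mathcal P_t$ be the group scheme over $\mathbb A^1_t$ of automorphisms of the system $(\mathcal V_i,\alpha_i)_i$: its $R$-points are the tuples $(g_i)_i$ of automorphisms of the modules $\mathcal V_i\otimes R$ with $g_{i-1}\alpha_i=\alpha_i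 g_i$ for all $i$. Let $V=\mathbb A^n$, with its direct factor $\Omega=\mathbb A^r$ (the first $r$ coordinates). The rigidified local model $\mathbb M_t^{\rm rig}(\mathrm{GL}_n,r,(d_i))$ has as $R$-points the tuples $((\omega_i)_i,(\phi_i)_i)$, where $\omega_i\subset\mathcal V_i\otimes R$ is locally a direct factor of rank $r$, $\alpha_i(\omega_i)\subset\omega_{i-1}$ for all $i$, and $\phi_i:\mathcal V_i\otimes R\to V\otimes R$ is an isomorphism with $\phi_i(\omega_i)=\Omega\otimes R$. The group scheme $\mathcal P_t$ acts on it on the left by $g\cdot(\omega_i,\phi_i)_i=(g_i\omega_i,\phi_i g_i^{-1})_i$. Let $P\subset\mathrm{GL}_n$ be the parabolic subgroup stabilizing $\Omega$, and let $\mathfrak P$ be its Lie algebra. Let $\mu^{P,N}$ be the closed subscheme of $(\mathfrak P\setminus\{0\})^{N+1}\times\mathbb A^1_t$ of tuples $(\Pi_0,\dots,\Pi_N)$ with $\Pi_i\Pi_{i+1}\cdots\Pi_{i+N}=t\cdot\mathrm{Id}_n$ for all $i$. Let $\mu^{P,N}_{(d_i)}\subset\mu^{P,N}$ be the locus where, for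 every $i$, the minors of size $n-d_i$ of $\Pi_i$ generate the unit ideal. Then $\mu^{P,N}_{(d_i)}$ is an open subscheme of $\mu^{P,N}$, the formula $\Pi_i=\phi_{i-1}\alpha_i\phi_i^{-1}$ defines a morphism $\mathbb M_t^{\rm rig}(\mathrm{GL}_n,r,(d_i))\to\mu^{P,N}_{(d_i)}$ of schemes over $\mathbb A^1_t$, and this morphism makes $\mathbb M_t^{\rm rig}(\mathrm{GL}_n,r,(d_i))$ a Zariski-locally trivial principal homogeneous space under $\mathcal P_t$ over $\mu^{P,N}_{(d_i)}$: the group $\mathcal P_t$ acts on it over $\mu^{P,N}_{(d_i)}$, the map $(g,x)\mapsto(gx,x)$ is an isomorphism $\mathcal P_t\times_{\mathbb A^1_t}\mathbb M_t^{\rm rig}\to\mathbb M_t^{\rm rig}\times_{\mu^{P,N}_{(d_i)}}\mathbb M_t^{\rm rig}$, and Zariski-locally on $\mu^{P,N}_{(d_i)}$ the morphism has a section. -/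

import Mathlib

open CategoryTheory
open scoped Polynomial TensorProduct

universe u

namespace UnitaryLocalModel



/-! Throughout, `ℤ[X]` is the coordinate ring of the affine line `𝔸¹_t`, with `t = X`, and a scheme
over `𝔸¹_t` is given by its functor of points on commutative `ℤ[X]`-algebras.
The indices in `ℤ/(N+1)` are elements of `Fin (N + 1)`, with cyclic arithmetic; the tuple
`(d_1, …, d_{N+1})` is the function `d : Fin (N + 1) → ℕ`, with `d 0` standing for `d_{N+1}`. -/

/-! ### The lattices and their inclusions -/

/-- The matrix `T`, with the identity of size `n - 1` in the upper right corner and `t` in the lower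
left corner. -/
noncomputable def shiftMatrix (n : ℕ) : Matrix (Fin n) (Fin n) ℤ[X] := fun a b =>
  if (b : ℕ) = a + 1 then 1 else if (a : ℕ) + 1 = n ∧ (b : ℕ) = 0 then Polynomial.X else 0

lemma shiftMatrix_pow (n k : ℕ) (hk : k ≤ n) (a b : Fin n) :
    (shiftMatrix n ^ k) a b =
      if (b : ℕ) = a + k then 1 else if (b : ℕ) + n = a + k then Polynomial.X else 0 := by
  induction k generalizing a b with
  | zero =>
    have := b.2
    have := a.2
    rw [pow_zero, Matrix.one_apply]
    by_cases h : a = b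
    · subst h; simp
    · have h' : (b : ℕ) ≠ a := fun e => h (Fin.ext e.symm)
      rw [if_neg h, if_neg (by omega), if_neg (by omega)]
  | succ k ih =>
    have hb := b.2
    have ha := a.2
    rw [pow_succ', Matrix.mul_apply]
    by_cases h : (a : ℕ) + 1 < n
    · rw [Finset.sum_eq_single (⟨a + 1, h⟩ : Fin n)]
      · rw [ih (by omega)]
        simp only [shiftMatrix, if_true, one_mul]
        split_ifs <;> first | rfl | omega
      · intro c _ hc
        have hc' : (c : ℕ) ≠ a + 1 := fun e => hc (Fin.ext e)
        rw [shiftMatrix, if_neg hc', if_neg (by omega), zero_mul]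
      · simp
    · rw [Finset.sum_eq_single (⟨0, by omega⟩ : Fin n)]
      · rw [ih (by omega)]
        simp only [shiftMatrix]
        rw [if_neg (by omega), if_pos ⟨by omega, trivial⟩]
        split_ifs <;> first | omega | simp
      · intro c _ hc
        have hc' : (c : ℕ) ≠ 0 := fun e => hc (Fin.ext e)
        have := c.2
        rw [shiftMatrix, if_neg (by omega), if_neg (by omega), zero_mul]
      · simp

lemma shiftMatrix_pow_self (n : ℕ) :
    shiftMatrix n ^ n = (Polynomial.X : ℤ[X]) • (1 : Matrix (Fin n) (Fin n) ℤ[X]) := by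
  ext1 a b
  have hb := b.2
  rw [shiftMatrix_pow n n le_rfl, if_neg (by omega), Matrix.smul_apply, Matrix.one_apply]
  by_cases h : a = b
  · subst h; simp
  · have h' : (b : ℕ) ≠ a := fun e => h (Fin.ext e.symm)
    rw [if_neg (by omega), if_neg h, smul_zero]

section Lattices

variable {N : ℕ} (d : Fin (N + 1) → ℕ)

/-- `n = d_1 + ⋯ + d_{N+1}`. -/
abbrev dim : ℕ := ∑ i, d i

/-- `d_1 + ⋯ + d_i`, for `0 ≤ i ≤ N`. -/
def partialSum (i : Fin (N + 1)) : ℕ := ∑ j ∈ Finset.Ioc 0 i, d j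

/-- The lattice `𝒱_i = T ^ (d_1 + ⋯ + d_i) ℤ[t]ⁿ`, for `0 ≤ i ≤ N`. It is contained in `ℤ[t]ⁿ`. -/
noncomputable def lattice (i : Fin (N + 1)) : Submodule ℤ[X] (Fin (dim d) → ℤ[X]) :=
  LinearMap.range (shiftMatrix (dim d) ^ partialSum d i).mulVecLin

/-- Multiplication by `t` for `i = 0`, and the identity otherwise. -/
noncomputable def scaling (i : Fin (N + 1)) :
    (Fin (dim d) → ℤ[X]) →ₗ[ℤ[X]] (Fin (dim d) → ℤ[X]) :=
  if i = 0 then (Polynomial.X : ℤ[X]) • LinearMap.id else LinearMap.id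

lemma partialSum_last_add : partialSum d (Fin.last N) + d 0 = dim d := by
  have h : Finset.Ioc 0 (Fin.last N) = Finset.univ.erase 0 := by
    ext j
    simp [Fin.pos_iff_ne_zero, Fin.le_last]
  rw [partialSum, h, Finset.sum_erase_add _ _ (Finset.mem_univ _)]

lemma partialSum_sub_one (i : Fin (N + 1)) (hi : i ≠ 0) :
    partialSum d i = partialSum d (i - 1) + d i := by
  have hv : ((i - 1 : Fin (N + 1)) : ℕ) = i - 1 := Fin.val_sub_one_of_ne_zero hi
  have hi' : (i : ℕ) ≠ 0 := fun e => hi (Fin.ext e)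
  have h : Finset.Ioc 0 i = insert i (Finset.Ioc 0 (i - 1)) := by
    ext j
    simp only [Finset.mem_Ioc, Finset.mem_insert, Fin.lt_def, Fin.le_def, Fin.ext_iff, hv,
      Fin.val_zero]
    omega
  have hn : i ∉ Finset.Ioc 0 (i - 1) := by
    simp only [Finset.mem_Ioc, Fin.lt_def, Fin.le_def, hv]
    omega
  rw [partialSum, h, Finset.sum_insert hn, partialSum, add_comm]

lemma scaling_mem (i : Fin (N + 1)) (v) (hv : v ∈ lattice d i) :
    scaling d i v ∈ lattice d (i - 1) := by
  obtain ⟨w, rfl⟩ := hv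
  by_cases hi : i = 0
  · subst hi
    have h0 : (0 - 1 : Fin (N + 1)) = Fin.last N := by
      rw [zero_sub, eq_comm, eq_neg_iff_add_eq_zero, Fin.last_add_one]
    have hp : partialSum d 0 = 0 := by simp [partialSum]
    refine ⟨(shiftMatrix (dim d) ^ d 0).mulVec w, ?_⟩
    rw [h0, Matrix.mulVecLin_apply, Matrix.mulVec_mulVec, ← pow_add, partialSum_last_add,
      shiftMatrix_pow_self, hp]
    simp [scaling, Matrix.smul_mulVec]
  · refine ⟨(shiftMatrix (dim d) ^ d i).mulVec w, ?_⟩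
    rw [Matrix.mulVecLin_apply, Matrix.mulVec_mulVec, ← pow_add, ← partialSum_sub_one d i hi]
    simp [scaling, hi]

/-- `α_i : 𝒱_i → 𝒱_{i-1}` for `i ∈ ℤ/(N+1)`. It is the inclusion for `1 ≤ i ≤ N`; for `i = 0` it is
the composite of the isomorphism of `𝒱_0` with `𝒱_{N+1} = T ^ n 𝒱_0 = t 𝒱_0` given by
multiplication by `t`, and of the inclusion of `𝒱_{N+1}` into `𝒱_N`. -/
noncomputable def latticeMap (i : Fin (N + 1)) :
    lattice d i →ₗ[ℤ[X]] lattice d (i - 1) :=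
  (scaling d i).restrict (scaling_mem d i)

end Lattices

/-! ### Base change -/

section DirectFactor

variable {R : Type u} [CommRing R]

/-- `W` is (locally) a direct factor of rank `r` of the module `V`. For a free module of finite rank
`V`, being a direct factor is Zariski-local on the base. -/
structure IsDirectFactor {V : Type*} [AddCommGroup V] [Module R V] (r : ℕ)
    (W : Submodule R V) : Prop where
  exists_isCompl : ∃ W' : Submodule R V, IsCompl W W'
  rank_eq : ∀ p : PrimeSpectrum R, Module.rankAtStalk W p = r

lemma IsDirectFactor.map_equiv {V V' : Type*} [AddCommGroup V] [Module R V] [AddCommGroup V']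
    [Module R V'] {r : ℕ} {W : Submodule R V} (h : IsDirectFactor r W) (e : V ≃ₗ[R] V') :
    IsDirectFactor r (W.map e.toLinearMap) := by
  obtain ⟨⟨W', hW'⟩, hr⟩ := h
  refine ⟨⟨W'.map e.toLinearMap, ?_⟩, fun p => ?_⟩
  · exact hW'.map (Submodule.orderIsoMapComap e)
  · rw [← hr p, Module.rankAtStalk_eq_of_equiv (e.submoduleMap W)]

end DirectFactor

section Push

variable {R S Q : Type u} [CommRing R] [CommRing S] [CommRing Q]
  [Algebra ℤ[X] R] [Algebra ℤ[X] S] [Algebra ℤ[X] Q]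
variable {M₁ M₂ M₃ : Type} [AddCommGroup M₁] [AddCommGroup M₂] [AddCommGroup M₃]
  [Module ℤ[X] M₁] [Module ℤ[X] M₂] [Module ℤ[X] M₃]

/-- The map `R ⊗ M → S ⊗ M` induced by `f : R → S`. -/
noncomputable def extScalars (f : R →ₐ[ℤ[X]] S) (M : Type) [AddCommGroup M] [Module ℤ[X] M] :
    R ⊗[ℤ[X]] M →ₗ[ℤ[X]] S ⊗[ℤ[X]] M :=
  f.toLinearMap.rTensor M

@[simp] lemma extScalars_tmul (f : R →ₐ[ℤ[X]] S) (a : R) (m : M₁) :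
    extScalars f M₁ (a ⊗ₜ m) = f a ⊗ₜ m := rfl

lemma extScalars_smul (f : R →ₐ[ℤ[X]] S) (a : R) (x : R ⊗[ℤ[X]] M₁) :
    extScalars f M₁ (a • x) = f a • extScalars f M₁ x := by
  induction x with
  | zero => simp
  | tmul b m => simp [TensorProduct.smul_tmul']
  | add x y hx hy => rw [smul_add, map_add, hx, hy, map_add, smul_add]

lemma extScalars_id (x : R ⊗[ℤ[X]] M₁) : extScalars (AlgHom.id ℤ[X] R) M₁ x = x := by
  induction x with
  | zero => simp
  | tmul b m => simp
  | add x y hx hy => rw [map_add, hx, hy]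

lemma extScalars_comp (f : R →ₐ[ℤ[X]] S) (g : S →ₐ[ℤ[X]] Q) (x : R ⊗[ℤ[X]] M₁) :
    extScalars (g.comp f) M₁ x = extScalars g M₁ (extScalars f M₁ x) := by
  induction x with
  | zero => simp
  | tmul b m => simp
  | add x y hx hy => simp only [map_add, hx, hy]

/-- The base change along `f : R → S` of an `R`-linear map `R ⊗ M₁ → R ⊗ M₂`: the unique `S`-linear
map `S ⊗ M₁ → S ⊗ M₂` compatible with it. -/
noncomputable def push (f : R →ₐ[ℤ[X]] S) (h : R ⊗[ℤ[X]] M₁ →ₗ[R] R ⊗[ℤ[X]] M₂) :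
    S ⊗[ℤ[X]] M₁ →ₗ[S] S ⊗[ℤ[X]] M₂ :=
  LinearMap.liftBaseChange S
    (extScalars f M₂ ∘ₗ h.restrictScalars ℤ[X] ∘ₗ TensorProduct.mk ℤ[X] R M₁ 1)

lemma push_tmul (f : R →ₐ[ℤ[X]] S) (h : R ⊗[ℤ[X]] M₁ →ₗ[R] R ⊗[ℤ[X]] M₂) (s : S) (m : M₁) :
    push f h (s ⊗ₜ m) = s • extScalars f M₂ (h (1 ⊗ₜ m)) := by
  simp [push, LinearMap.liftBaseChange_tmul]

lemma push_ext (f : R →ₐ[ℤ[X]] S) (h : R ⊗[ℤ[X]] M₁ →ₗ[R] R ⊗[ℤ[X]] M₂)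
    (x : R ⊗[ℤ[X]] M₁) : push f h (extScalars f M₁ x) = extScalars f M₂ (h x) := by
  induction x with
  | zero => simp
  | tmul b m =>
    rw [extScalars_tmul, push_tmul, ← extScalars_smul, ← map_smul, TensorProduct.smul_tmul', smul_eq_mul, mul_one]
  | add x y hx hy => simp only [map_add, hx, hy]

lemma eq_push (f : R →ₐ[ℤ[X]] S) (h : R ⊗[ℤ[X]] M₁ →ₗ[R] R ⊗[ℤ[X]] M₂)
    (k : S ⊗[ℤ[X]] M₁ →ₗ[S] S ⊗[ℤ[X]] M₂)
    (hk : ∀ x, k (extScalars f M₁ x) = extScalars f M₂ (h x)) : k = push f h := by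
  refine TensorProduct.AlgebraTensorModule.ext fun s m => ?_
  have : s ⊗ₜ[ℤ[X]] m = s • extScalars f M₁ (1 ⊗ₜ m) := by
    rw [extScalars_tmul, map_one, TensorProduct.smul_tmul', smul_eq_mul, mul_one]
  rw [this, map_smul, map_smul, hk, push_ext]

lemma push_id (f : R →ₐ[ℤ[X]] S) :
    push f (LinearMap.id : R ⊗[ℤ[X]] M₁ →ₗ[R] R ⊗[ℤ[X]] M₁) = LinearMap.id :=
  (eq_push f _ _ fun _ => rfl).symm

lemma push_comp (f : R →ₐ[ℤ[X]] S) (k : R ⊗[ℤ[X]] M₂ →ₗ[R] R ⊗[ℤ[X]] M₃)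
    (h : R ⊗[ℤ[X]] M₁ →ₗ[R] R ⊗[ℤ[X]] M₂) : push f (k ∘ₗ h) = push f k ∘ₗ push f h :=
  (eq_push f _ _ fun x => by simp [push_ext]).symm

lemma push_idHom (h : R ⊗[ℤ[X]] M₁ →ₗ[R] R ⊗[ℤ[X]] M₂) :
    push (AlgHom.id ℤ[X] R) h = h :=
  (eq_push _ _ _ fun x => by simp [extScalars_id]).symm

lemma push_compHom (f : R →ₐ[ℤ[X]] S) (g : S →ₐ[ℤ[X]] Q)
    (h : R ⊗[ℤ[X]] M₁ →ₗ[R] R ⊗[ℤ[X]] M₂) : push (g.comp f) h = push g (push f h) :=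
  (eq_push _ _ _ fun x => by simp [extScalars_comp, push_ext]).symm

lemma push_baseChange (f : R →ₐ[ℤ[X]] S) (h : M₁ →ₗ[ℤ[X]] M₂) :
    push f (h.baseChange R) = h.baseChange S := by
  refine TensorProduct.AlgebraTensorModule.ext fun s m => ?_
  rw [push_tmul, LinearMap.baseChange_tmul, LinearMap.baseChange_tmul, extScalars_tmul, map_one,
    TensorProduct.smul_tmul', smul_eq_mul, mul_one]

/-- The base change along `f : R → S` of an isomorphism `R ⊗ M₁ ≃ R ⊗ M₂`. -/
noncomputable def pushEquiv (f : R →ₐ[ℤ[X]] S) (e : (R ⊗[ℤ[X]] M₁) ≃ₗ[R] (R ⊗[ℤ[X]] M₂)) :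
    (S ⊗[ℤ[X]] M₁) ≃ₗ[S] (S ⊗[ℤ[X]] M₂) :=
  LinearEquiv.ofLinearMap (push f e.toLinearMap) (push f e.symm.toLinearMap)
    (by rw [← push_comp, LinearEquiv.comp_symm, push_id])
    (by rw [← push_comp, LinearEquiv.symm_comp, push_id])

lemma coe_pushEquiv (f : R →ₐ[ℤ[X]] S) (e : (R ⊗[ℤ[X]] M₁) ≃ₗ[R] (R ⊗[ℤ[X]] M₂)) :
    (pushEquiv f e).toLinearMap = push f e.toLinearMap := rfl

lemma coe_pushEquiv_symm (f : R →ₐ[ℤ[X]] S) (e : (R ⊗[ℤ[X]] M₁) ≃ₗ[R] (R ⊗[ℤ[X]] M₂)) :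
    (pushEquiv f e).symm.toLinearMap = push f e.symm.toLinearMap := rfl

/-- The base change along `f : R → S` of a submodule of `R ⊗ M`: the submodule of `S ⊗ M` spanned
by its image. -/
noncomputable def pushSub (f : R →ₐ[ℤ[X]] S) (W : Submodule R (R ⊗[ℤ[X]] M₁)) :
    Submodule S (S ⊗[ℤ[X]] M₁) :=
  Submodule.span S (extScalars f M₁ '' W)

lemma pushSub_idHom (W : Submodule R (R ⊗[ℤ[X]] M₁)) :
    pushSub (AlgHom.id ℤ[X] R) W = W := by
  have : (extScalars (AlgHom.id ℤ[X] R) M₁ '' W) = W := by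
    ext x; simp [extScalars_id]
  rw [pushSub, this, Submodule.span_eq]

lemma pushSub_span (f : R →ₐ[ℤ[X]] S) (s : Set (R ⊗[ℤ[X]] M₁)) :
    pushSub f (Submodule.span R s) = Submodule.span S (extScalars f M₁ '' s) := by
  refine le_antisymm (Submodule.span_le.2 ?_)
    (Submodule.span_mono (Set.image_mono Submodule.subset_span))
  rintro _ ⟨x, hx, rfl⟩
  induction hx using Submodule.span_induction with
  | mem x h => exact Submodule.subset_span ⟨x, h, rfl⟩
  | zero => simp
  | add x y _ _ hx hy => rw [map_add]; exact add_mem hx hy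
  | smul a x _ hx => rw [extScalars_smul]; exact Submodule.smul_mem _ _ hx

lemma pushSub_compHom (f : R →ₐ[ℤ[X]] S) (g : S →ₐ[ℤ[X]] Q)
    (W : Submodule R (R ⊗[ℤ[X]] M₁)) : pushSub (g.comp f) W = pushSub g (pushSub f W) := by
  conv_rhs => rw [pushSub.eq_def f, pushSub_span, Set.image_image]
  simp only [pushSub, extScalars_comp]

lemma pushSub_map (f : R →ₐ[ℤ[X]] S) (h : R ⊗[ℤ[X]] M₁ →ₗ[R] R ⊗[ℤ[X]] M₂)
    (W : Submodule R (R ⊗[ℤ[X]] M₁)) :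
    pushSub f (W.map h) = (pushSub f W).map (push f h) := by
  rw [pushSub, pushSub, Submodule.map_span, Set.image_image, Submodule.map_coe, Set.image_image]
  simp only [push_ext]

lemma pushSub_mono (f : R →ₐ[ℤ[X]] S) {W W' : Submodule R (R ⊗[ℤ[X]] M₁)} (h : W ≤ W') :
    pushSub f W ≤ pushSub f W' :=
  Submodule.span_mono (Set.image_mono h)

lemma pushSub_baseChange (f : R →ₐ[ℤ[X]] S) (W : Submodule ℤ[X] M₁) :
    pushSub f (W.baseChange R) = W.baseChange S := by
  rw [Submodule.baseChange_eq_span, Submodule.baseChange_eq_span, pushSub_span, Submodule.map_coe,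
    Submodule.map_coe, Set.image_image]
  simp only [TensorProduct.mk_apply, extScalars_tmul, map_one]
  rfl

lemma isDirectFactor_push [Module.Finite ℤ[X] M₁] [Module.Projective ℤ[X] M₁] (f : R →ₐ[ℤ[X]] S) {r : ℕ} {W : Submodule R (R ⊗[ℤ[X]] M₁)}
    (h : IsDirectFactor r W) : IsDirectFactor r (pushSub f W) := by
  obtain ⟨⟨W', hW'⟩, hr⟩ := h
  let q : R ⊗[ℤ[X]] M₁ →ₗ[R] W := W.projectionOnto W' hW'
  have hq : ∀ w : W, q w = w := fun w => Submodule.projectionOnto_apply_left hW' w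
  refine ⟨?_, fun p => ?_⟩
  · let P : R ⊗[ℤ[X]] M₁ →ₗ[R] R ⊗[ℤ[X]] M₁ := W.subtype ∘ₗ q
    have hP : P ∘ₗ P = P := by
      ext x
      simp [P, hq]
    have hPr : Submodule.map P ⊤ = W := by
      refine le_antisymm ?_ fun x hx => ⟨x, trivial, ?_⟩
      · rintro _ ⟨x, -, rfl⟩
        exact (q x).2
      · exact congrArg Subtype.val (hq ⟨x, hx⟩)
    have hi : IsIdempotentElem (push f P) := by
      change push f P ∘ₗ push f P = push f P
      rw [← push_comp, hP]
    have hrange : LinearMap.range (push f P) = pushSub f W := by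
      rw [LinearMap.range_eq_map, ← Submodule.baseChange_top (R := ℤ[X]) (M := M₁),
        ← pushSub_baseChange f, ← pushSub_map, Submodule.baseChange_top, hPr]
    exact ⟨_, hrange ▸ LinearMap.IsIdempotentElem.isCompl hi⟩
  · let _ : Algebra R S := f.toRingHom.toAlgebra
    have : IsScalarTower ℤ[X] R S := IsScalarTower.of_algebraMap_eq fun x => (f.commutes x).symm
    have hsm : ∀ (a : R) (y : S ⊗[ℤ[X]] M₁), f a • y = a • y := fun a y => by
      rw [← algebraMap_smul S a y]; rfl
    let j₀ : W →ₗ[R] S ⊗[ℤ[X]] M₁ :=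
      { toFun := fun w => extScalars f M₁ w
        map_add' := fun x y => by simp
        map_smul' := fun a x => by
          rw [RingHom.id_apply, Submodule.coe_smul, extScalars_smul, hsm] }
    let j : S ⊗[R] W →ₗ[S] S ⊗[ℤ[X]] M₁ := LinearMap.liftBaseChange S j₀
    have hj : ∀ s w, j (s ⊗ₜ w) = s • extScalars f M₁ w := fun s w => LinearMap.liftBaseChange_tmul ..
    let k₀ : M₁ →ₗ[ℤ[X]] S ⊗[R] W :=
      ((TensorProduct.mk R S W 1) ∘ₗ q).restrictScalars ℤ[X] ∘ₗ TensorProduct.mk ℤ[X] R M₁ 1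
    let k : S ⊗[ℤ[X]] M₁ →ₗ[S] S ⊗[R] W := LinearMap.liftBaseChange S k₀
    have hk : ∀ x, k (extScalars f M₁ x) = 1 ⊗ₜ q x := by
      intro x
      induction x with
      | zero => simp
      | tmul a m =>
        have e : a ⊗ₜ[ℤ[X]] m = a • (1 ⊗ₜ m : R ⊗[ℤ[X]] M₁) := by
          rw [TensorProduct.smul_tmul', smul_eq_mul, mul_one]
        have e' : f a = a • (1 : S) := by rw [Algebra.smul_def, mul_one]; rfl
        have h₁ : k (f a ⊗ₜ m) = f a • (1 : S) ⊗ₜ[R] q (1 ⊗ₜ m) :=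
          LinearMap.liftBaseChange_tmul ..
        rw [extScalars_tmul, h₁, e, map_smul, TensorProduct.smul_tmul', smul_eq_mul, mul_one, e',
          TensorProduct.smul_tmul]
      | add x y hx hy => rw [map_add, map_add, map_add, hx, hy, TensorProduct.tmul_add]
    have hkj : ∀ x, k (j x) = x := by
      intro x
      induction x with
      | zero => simp
      | tmul s w =>
        rw [hj, map_smul, hk, hq, TensorProduct.smul_tmul', smul_eq_mul, mul_one]
      | add x y hx hy => rw [map_add, map_add, hx, hy]
    have hrange : LinearMap.range j = pushSub f W := by
      refine le_antisymm ?_ (Submodule.span_le.2 ?_)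
      · rintro _ ⟨x, rfl⟩
        induction x with
        | zero => simp
        | tmul s w =>
          rw [hj]
          exact Submodule.smul_mem _ _ (Submodule.subset_span ⟨w, w.2, rfl⟩)
        | add x y hx hy => rw [map_add]; exact add_mem hx hy
      · rintro _ ⟨w, hw, rfl⟩
        exact ⟨1 ⊗ₜ ⟨w, hw⟩, by rw [hj, one_smul]⟩
    have e : (S ⊗[R] W) ≃ₗ[S] pushSub f W :=
      (LinearEquiv.ofInjective j (Function.LeftInverse.injective hkj)).trans
        (LinearEquiv.ofEq _ _ hrange)
    have : Module.Finite R W := Module.Finite.of_surjective q fun w => ⟨w, hq w⟩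
    have : Module.Projective R W :=
      Module.Projective.of_split W.subtype q (LinearMap.ext fun w => hq w)
    rw [← Module.rankAtStalk_eq_of_equiv e]
    exact (Module.rankAtStalk_baseChange p).trans (hr _)

end Push

/-! ### The local model, its rigidification, and the group `𝒫_t` -/

section Points

variable {N : ℕ} (r : ℕ) (d : Fin (N + 1) → ℕ) (R S Q : Type u) [CommRing R] [CommRing S]
  [CommRing Q] [Algebra ℤ[X] R] [Algebra ℤ[X] S] [Algebra ℤ[X] Q]

/-- The direct factor `Ω = 𝔸ʳ` of `V = 𝔸ⁿ` (first `r` coordinates), over `ℤ[t]`. -/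
def stdSub (n : ℕ) : Submodule ℤ[X] (Fin n → ℤ[X]) where
  carrier := {v | ∀ a : Fin n, r ≤ a → v a = 0}
  add_mem' hv hw a ha := by simp [hv a ha, hw a ha]
  zero_mem' _ _ := rfl
  smul_mem' c v hv a ha := by simp [hv a ha]

/-- The `R`-points of the local model `𝕄_t(GL_n, r, (d_i))`. -/
structure LocalModel where
  /-- The submodule `ω_i` of `𝒱_i ⊗ R`. -/
  ω : ∀ i, Submodule R (R ⊗[ℤ[X]] lattice d i)
  isDirectFactor : ∀ i, IsDirectFactor r (ω i)
  map_le : ∀ i, (ω i).map ((latticeMap d i).baseChange R) ≤ ω (i - 1)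

/-- The `R`-points of the rigidified local model: points of the local model with isomorphisms
`φ_i` of filtered modules from `ω_i ⊂ 𝒱_i ⊗ R` to `Ω ⊗ R ⊂ V ⊗ R`. -/
@[ext]
structure RigLocalModel extends LocalModel r d R where
  /-- The isomorphism `φ_i`. -/
  φ : ∀ i, (R ⊗[ℤ[X]] lattice d i) ≃ₗ[R] (R ⊗[ℤ[X]] (Fin (dim d) → ℤ[X]))
  map_φ : ∀ i, (ω i).map (φ i).toLinearMap = (stdSub r (dim d)).baseChange R

variable {d R} in
/-- `g` is an automorphism of the system `(𝒱_i ⊗ R, α_i)_i`: it satisfies `g_{i-1} α_i = α_i g_i`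
for all `i ∈ ℤ/(N+1)`. -/
def IsSystemAut (g : ∀ i, (R ⊗[ℤ[X]] lattice d i) ≃ₗ[R] (R ⊗[ℤ[X]] lattice d i)) : Prop :=
  ∀ i x, g (i - 1) ((latticeMap d i).baseChange R x) = (latticeMap d i).baseChange R (g i x)

variable {d R} in
lemma isSystemAut_iff {g : ∀ i, (R ⊗[ℤ[X]] lattice d i) ≃ₗ[R] (R ⊗[ℤ[X]] lattice d i)} :
    IsSystemAut g ↔ ∀ i, (g (i - 1)).toLinearMap ∘ₗ (latticeMap d i).baseChange R =
      (latticeMap d i).baseChange R ∘ₗ (g i).toLinearMap := by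
  constructor
  · intro h i
    refine LinearMap.ext ?_
    intro x
    exact h i x
  · intro h i x
    have := h i
    exact LinearMap.congr_fun this x

/-- The group of `R`-points of `𝒫_t`: the automorphisms of the system `(𝒱_i ⊗ R, α_i)_i`. -/
def autGroup : Subgroup (∀ i, (R ⊗[ℤ[X]] lattice d i) ≃ₗ[R] (R ⊗[ℤ[X]] lattice d i)) where
  carrier := {g | IsSystemAut g}
  one_mem' _ _ := rfl
  mul_mem' {g h} hg hh i x := by
    rw [Pi.mul_apply, Pi.mul_apply, LinearEquiv.mul_apply, LinearEquiv.mul_apply, hh i, hg i]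
  inv_mem' {g} hg i x := by
    rw [Pi.inv_apply, Pi.inv_apply]
    refine (LinearEquiv.symm_apply_eq (g (i - 1))).2 ?_
    rw [hg i]
    exact congrArg _ ((g i).apply_symm_apply x).symm

variable {r d R S Q}

lemma mem_autGroup {g : ∀ i, (R ⊗[ℤ[X]] lattice d i) ≃ₗ[R] (R ⊗[ℤ[X]] lattice d i)} :
    g ∈ autGroup d R ↔ IsSystemAut g := Iff.rfl

lemma autGroup_comm (g : autGroup d R) (i : Fin (N + 1)) :
    (g.1 (i - 1)).toLinearMap ∘ₗ (latticeMap d i).baseChange R =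
      (latticeMap d i).baseChange R ∘ₗ (g.1 i).toLinearMap :=
  isSystemAut_iff.1 (mem_autGroup.1 g.2) i

/-- The action `g • (ω, φ) = (g ω, φ g⁻¹)` of `𝒫_t` on the rigidified local model. -/
noncomputable def RigLocalModel.smul (g : autGroup d R) (x : RigLocalModel r d R) :
    RigLocalModel r d R where
  ω i := (x.ω i).map (g.1 i).toLinearMap
  isDirectFactor i := (x.isDirectFactor i).map_equiv _
  map_le i := by
    rw [← Submodule.map_comp, ← autGroup_comm g i, Submodule.map_comp]
    exact Submodule.map_mono (x.map_le i)
  φ i := (g.1 i).symm.trans (x.φ i)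
  map_φ i := by
    rw [← x.map_φ i, ← Submodule.map_comp]
    congr 1
    exact LinearMap.ext fun y => congrArg (x.φ i) ((g.1 i).symm_apply_apply y)

/-- The morphism on points of the rigidified local models induced by `f : R → S`. -/
noncomputable def RigLocalModel.map (f : R →ₐ[ℤ[X]] S) (x : RigLocalModel r d R) :
    RigLocalModel r d S where
  ω i := pushSub f (x.ω i)
  isDirectFactor i := by
    have h := isDirectFactor_push f ((x.isDirectFactor i).map_equiv (x.φ i))
    rw [pushSub_map, ← coe_pushEquiv] at h
    have h' := h.map_equiv (pushEquiv f (x.φ i)).symm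
    rwa [← Submodule.map_comp, LinearEquiv.symm_comp, Submodule.map_id] at h'
  map_le i := by
    rw [← push_baseChange f, ← pushSub_map]
    exact pushSub_mono f (x.map_le i)
  φ i := pushEquiv f (x.φ i)
  map_φ i := by
    rw [coe_pushEquiv, ← pushSub_map, x.map_φ, pushSub_baseChange]

lemma pushEquiv_comm (f : R →ₐ[ℤ[X]] S) (g : autGroup d R) (i : Fin (N + 1)) :
    (pushEquiv f (g.1 (i - 1))).toLinearMap ∘ₗ (latticeMap d i).baseChange S =
      (latticeMap d i).baseChange S ∘ₗ (pushEquiv f (g.1 i)).toLinearMap := by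
  rw [coe_pushEquiv, coe_pushEquiv, ← push_baseChange f, ← push_comp, ← push_comp, autGroup_comm]

/-- The map on points of `𝒫_t` induced by `f : R → S`. -/
noncomputable def autGroupMapFun (f : R →ₐ[ℤ[X]] S) (g : autGroup d R) : autGroup d S :=
  ⟨fun i => pushEquiv f (g.1 i), mem_autGroup.2 (isSystemAut_iff.2 (pushEquiv_comm f g))⟩

lemma autGroup_ext {g h : autGroup d R} (e : ∀ i, (g.1 i).toLinearMap = (h.1 i).toLinearMap) :
    g = h :=
  Subtype.ext (funext fun i => LinearEquiv.toLinearMap_injective (e i))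

/-- The homomorphism on points of `𝒫_t` induced by `f : R → S`. -/
noncomputable def autGroupMap (d : Fin (N + 1) → ℕ) (f : R →ₐ[ℤ[X]] S) :
    autGroup d R →* autGroup d S :=
  MonoidHom.mk' (autGroupMapFun f) fun _ _ => autGroup_ext fun _ => push_comp f _ _

lemma autGroupMap_coe (f : R →ₐ[ℤ[X]] S) (g : autGroup d R) (i : Fin (N + 1)) :
    ((autGroupMap d f g).1 i).toLinearMap = push f (g.1 i).toLinearMap := rfl

lemma RigLocalModel.ext' {x y : RigLocalModel r d R} (h : ∀ i, x.ω i = y.ω i)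
    (h' : ∀ i, (x.φ i).toLinearMap = (y.φ i).toLinearMap) : x = y :=
  RigLocalModel.ext (funext h) (funext fun i => LinearEquiv.toLinearMap_injective (h' i))

/-- The matrix `Π_i` of `φ_{i-1} α_i φ_i⁻¹` in the standard basis of `V ⊗ R`. -/
noncomputable def RigLocalModel.transition (x : RigLocalModel r d R) (i : Fin (N + 1)) :
    Matrix (Fin (dim d)) (Fin (dim d)) R :=
  LinearMap.toMatrix
    (Algebra.TensorProduct.basis R (Pi.basisFun ℤ[X] (Fin (dim d))))
    (Algebra.TensorProduct.basis R (Pi.basisFun ℤ[X] (Fin (dim d))))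
    ((x.φ (i - 1)).toLinearMap ∘ₗ (latticeMap d i).baseChange R ∘ₗ (x.φ i).symm.toLinearMap)

end Points

/-! ### The scheme of matrix equations -/

section Mu

variable (r n : ℕ) (N : ℕ) {R S : Type u} [CommRing R] [CommRing S]

/-- The ideal generated by the minors of size `m` of a matrix. -/
def minorIdeal {n : ℕ} (m : ℕ) (A : Matrix (Fin n) (Fin n) R) : Ideal R :=
  Ideal.span (Set.range fun p : (Fin m ↪o Fin n) × (Fin m ↪o Fin n) =>
    (A.submatrix p.1 p.2).det)

lemma minorIdeal_map {n : ℕ} (m : ℕ) (A : Matrix (Fin n) (Fin n) R) (f : R →+* S) :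
    minorIdeal m (A.map f) = (minorIdeal m A).map f := by
  rw [minorIdeal, minorIdeal, Ideal.map_span, ← Set.range_comp]
  congr 2
  funext p
  simp [RingHom.map_det, Matrix.submatrix_map]

/-- `R`-points `(Π_0, …, Π_N)` of `μ^{P,N}`. -/
structure IsMu [Algebra ℤ[X] R] (A : Fin (N + 1) → Matrix (Fin n) (Fin n) R) : Prop where
  /-- `Π_i` lies in the Lie algebra of `P`: its lower left block vanishes. -/
  mem_lie : ∀ i (a b : Fin n), r ≤ a → (b : ℕ) < r → A i a b = 0
  /-- `Π_i` lies in the open subscheme `𝔓 - {0}` of `𝔓`: its entries generate the unit ideal. -/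
  rank_ge_one : ∀ i, Ideal.span (Set.range fun p : Fin n × Fin n => A i p.1 p.2) = ⊤
  /-- `Π_i Π_{i+1} ⋯ Π_{i+N} = t`, with cyclic indices. -/
  prod_eq : ∀ i, (List.ofFn fun k : Fin (N + 1) => A (i + k)).prod =
    algebraMap ℤ[X] R Polynomial.X • (1 : Matrix (Fin n) (Fin n) R)

variable {r n N} in
lemma IsMu.map [Algebra ℤ[X] R] [Algebra ℤ[X] S] (f : R →ₐ[ℤ[X]] S)
    {A : Fin (N + 1) → Matrix (Fin n) (Fin n) R} (h : IsMu r n N A) :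
    IsMu r n N fun i => (A i).map f where
  mem_lie i a b ha hb := by simp [h.mem_lie i a b ha hb]
  rank_ge_one i := by
    have := congrArg (Ideal.map f.toRingHom) (h.rank_ge_one i)
    rw [Ideal.map_span, Ideal.map_top, ← Set.range_comp] at this
    exact this
  prod_eq i := by
    have := congrArg (f.toRingHom.mapMatrix (m := Fin n)) (h.prod_eq i)
    rw [map_list_prod, List.map_ofFn] at this
    refine Eq.trans ?_ (this.trans ?_)
    · rfl
    · ext a b
      simp [Matrix.one_apply, apply_ite f, Algebra.algebraMap_eq_smul_one]

/-- The scheme `μ^{P,N}`, as a functor of points. -/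
noncomputable def mu : CommAlgCat.{u} ℤ[X] ⥤ Type u where
  obj R := {A : Fin (N + 1) → Matrix (Fin n) (Fin n) R // IsMu r n N A}
  map f := ↾fun A => ⟨fun i => (A.1 i).map f.hom, A.2.map f.hom⟩

/-- The open subscheme `μ^{P,N}_{(d_i)}` of `μ^{P,N}` on which, for all `i`, the minors of size
`n - d_i` of `Π_i` generate the unit ideal. -/
noncomputable def muOpen {N : ℕ} (d : Fin (N + 1) → ℕ) : Subfunctor (mu.{u} r (dim d) N) where
  obj _ := {A | ∀ i, minorIdeal (dim d - d i) (A.1 i) = ⊤}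
  map f A hA i := by
    change minorIdeal _ ((A.1 i).map f.hom.toRingHom) = ⊤
    rw [minorIdeal_map, hA i, Ideal.map_top]

end Mu

/-! ### Functors of points, actions, and principal homogeneous spaces -/

/-- The group scheme `𝒫_t`, as a functor of points. -/
noncomputable def groupScheme {N : ℕ} (d : Fin (N + 1) → ℕ) : CommAlgCat.{u} ℤ[X] ⥤ GrpCat.{u} where
  obj R := GrpCat.of (autGroup d R)
  map f := GrpCat.ofHom (autGroupMap d f.hom)
  map_id R := by
    ext1
    exact MonoidHom.ext fun g => autGroup_ext fun i => push_idHom _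
  map_comp f g := by
    ext1
    exact MonoidHom.ext fun g => autGroup_ext fun i => push_compHom _ _ _

/-- The rigidified local model, as a functor of points. -/
noncomputable def rigScheme (r : ℕ) {N : ℕ} (d : Fin (N + 1) → ℕ) :
    CommAlgCat.{u} ℤ[X] ⥤ Type u where
  obj R := RigLocalModel r d R
  map f := ↾RigLocalModel.map f.hom
  map_id R := by
    refine ConcreteCategory.hom_ext _ _ fun x => ?_
    exact RigLocalModel.ext' (fun i => pushSub_idHom _) fun i => push_idHom _
  map_comp f g := by
    refine ConcreteCategory.hom_ext _ _ fun x => ?_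
    exact RigLocalModel.ext' (fun i => pushSub_compHom _ _ _) fun i => push_compHom _ _ _

/-- A left action of a group functor `G` on a functor `F`. -/
structure LeftAction (G : CommAlgCat.{u} ℤ[X] ⥤ GrpCat.{u}) (F : CommAlgCat.{u} ℤ[X] ⥤ Type u) where
  /-- The action on points. -/
  smul : ∀ {R : CommAlgCat.{u} ℤ[X]}, G.obj R → F.obj R → F.obj R
  one_smul : ∀ {R : CommAlgCat.{u} ℤ[X]} (x : F.obj R), smul 1 x = x
  mul_smul : ∀ {R : CommAlgCat.{u} ℤ[X]} (g h : G.obj R) (x : F.obj R),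
    smul (g * h) x = smul g (smul h x)
  map_smul : ∀ {R S : CommAlgCat.{u} ℤ[X]} (f : R ⟶ S) (g : G.obj R) (x : F.obj R),
    F.map f (smul g x) = smul (G.map f g) (F.map f x)

/-- The action of `𝒫_t` on the rigidified local model, `g • (ω, φ) = (g ω, φ g⁻¹)`. -/
noncomputable def rigAction (r : ℕ) {N : ℕ} (d : Fin (N + 1) → ℕ) :
    LeftAction (groupScheme.{u} d) (rigScheme.{u} r d) where
  smul {R} (g : autGroup d R) (x : RigLocalModel r d R) := x.smul g
  one_smul _ := RigLocalModel.ext' (fun _ => Submodule.map_id _) fun _ => rfl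
  mul_smul _ _ _ := RigLocalModel.ext' (fun _ => Submodule.map_comp _ _ _) fun _ => rfl
  map_smul _ _ _ :=
    RigLocalModel.ext' (fun _ => pushSub_map _ _ _) fun _ => push_comp _ _ _

/-- The canonical morphism from `R` to its localization `R[1/f]`. -/
noncomputable def toAway (R : CommAlgCat.{u} ℤ[X]) (f : R) :
    R ⟶ CommAlgCat.of ℤ[X] (Localization.Away f) :=
  CommAlgCat.ofHom (IsScalarTower.toAlgHom ℤ[X] R (Localization.Away f))

/-- A subfunctor `Y` of `F` is open if, for every point `x` of `F` over `Spec R`, the locus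
of `Spec R` where `x` lies in `Y` is an open subscheme, the complement of `V(I)`. -/
def IsOpenSubfunctor {F : CommAlgCat.{u} ℤ[X] ⥤ Type u} (Y : Subfunctor F) : Prop :=
  ∀ (R : CommAlgCat.{u} ℤ[X]) (x : F.obj R), ∃ I : Ideal R,
    ∀ (S : CommAlgCat.{u} ℤ[X]) (f : R ⟶ S),
      F.map f x ∈ Y.obj S ↔ I.map f.hom.toRingHom = ⊤

/-- `π : F → Y` is a Zariski-locally trivial principal homogeneous space under `G`. -/
structure IsPrincipalHomogeneousSpace {G : CommAlgCat.{u} ℤ[X] ⥤ GrpCat.{u}}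
    {F Y : CommAlgCat.{u} ℤ[X] ⥤ Type u} (a : LeftAction G F) (π : F ⟶ Y) : Prop where
  /-- `G` acts on `F` over `Y`. -/
  app_smul : ∀ {R : CommAlgCat.{u} ℤ[X]} (g : G.obj R) (x : F.obj R),
    π.app R (a.smul g x) = π.app R x
  /-- `(g, x) ↦ (g x, x)` is an isomorphism from `G × F` to `F ×_Y F`. -/
  existsUnique_smul_eq : ∀ {R : CommAlgCat.{u} ℤ[X]} (x y : F.obj R),
    π.app R x = π.app R y → ∃! g : G.obj R, a.smul g x = y
  /-- Zariski-locally on `Y`, the morphism `π` has a section. -/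
  exists_local_section : ∀ {R : CommAlgCat.{u} ℤ[X]} (y : Y.obj R),
    ∃ s : Set R, Ideal.span s = ⊤ ∧ ∀ f ∈ s,
      ∃ x : F.obj (CommAlgCat.of ℤ[X] (Localization.Away f)),
        π.app _ x = Y.map (toAway R f) y

end UnitaryLocalModel

/-!
# Rigidified local models as principal homogeneous spaces

In the basis `T ^ (d_1 + ⋯ + d_i) e_b` of `𝒱_i`, every map `α_i`, including `α_0`, has the same kind
of matrix, namely `T ^ d_i` (`toMatrix_latticeMap`). If `B_i` is the matrix of `φ_i` in this basis,
the relation `Π_i = φ_{i-1} α_i φ_i⁻¹` becomes `Π_i B_i = B_{i-1} T ^ d_i`, with `B_i` invertible. A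
family of such matrices is called a frame of the system `(Π_i)` below.

Given a frame, the cyclic products of the `Π_i` are `T ^ n = t`, and the minors of size `n - d_i` of
`Π_i` generate the unit ideal, because over the residue field of any maximal ideal `Π_i` has the
rank of `T ^ d_i`, which is at least `n - d_i`. The stability of `ω` under the `α_i` says that `Π_i`
preserves `Ω`. So the morphism to `μ^{P,N}_{(d_i)}` is defined. Two points with the same `Π_i`
differ by `g_i = φ'_i⁻¹ φ_i`, and by nothing else, and this is an automorphism of the system.

The substance is the existence of frames Zariski-locally on the base. For a maximal ideal `I`, it
suffices to find matrices `B_i` with `Π_i B_i = B_{i-1} T ^ d_i` and determinants outside `I`, since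
one can then invert the determinants.

* If `t ∉ I`, take `B_i = Π_{i+1} ⋯ Π_N Π_0 T ^ (d_1 + ⋯ + d_i)` (`exists_frame_of_notMem`).
* If `t ∈ I`, choose for each `i` a minor of size `n - d_i` of `Π_i` outside `I`; the `d_i`
  coordinate vectors outside its rows then generate the cokernel of `Π_i` modulo `I`. The standard
  system is a sum of systems of rank one, each freely generated by one vector, where the maps are the
  identity except for one, which is multiplication by `t`. Hence these coordinate vectors define a
  morphism from the standard system to `(Π_i)`, whose matrices have the columns `chainCol`. Modulo
  `I` the product of the `Π_i` around the cycle is zero, so iterating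
  `R ^ n = span (v_i) + Π_i R ^ n` shows that this morphism is surjective modulo `I`
  (`isUnit_det_chainMatrix`, `exists_frame_of_mem`).

The open subscheme is cut out by the product of the ideals of minors.
-/

namespace UnitaryLocalModel

/-! ### Minors and ranks -/

lemma exists_orderEmbedding_linearIndependent {K V : Type*} [Field K] [AddCommGroup V] [Module K V]
    {n m : ℕ} (v : Fin n → V) (h : m ≤ Module.finrank K (Submodule.span K (Set.range v))) :
    ∃ p : Fin m ↪o Fin n, LinearIndependent K (v ∘ p) := by
  classical
  obtain ⟨κ, a, ha, hs, hl⟩ := exists_linearIndependent' K v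
  have : Fintype κ := Fintype.ofInjective a ha
  rw [← hs, finrank_span_eq_card hl, ← Finset.card_univ,
    ← Finset.card_image_of_injective _ ha] at h
  obtain ⟨s, hsub, hcard⟩ := Finset.exists_subset_card_eq h
  have hmem : ∀ j, ∃ k, a k = s.orderEmbOfFin hcard j := fun j => by
    simpa using hsub (s.orderEmbOfFin_mem hcard j)
  choose f hf using hmem
  have hinj : Function.Injective f := fun j j' e =>
    (s.orderEmbOfFin hcard).injective (by rw [← hf, ← hf, e])
  refine ⟨s.orderEmbOfFin hcard, ?_⟩
  have e : v ∘ s.orderEmbOfFin hcard = (v ∘ a) ∘ f := funext fun j => congrArg v (hf j).symm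
  rw [e]
  exact hl.comp f hinj

/-- Over a field, a matrix of rank at least `m` has a nonzero minor of size `m`: choose `m` independent
rows, and then `m` independent columns of the resulting matrix. -/
lemma exists_det_submatrix_ne_zero {K : Type*} [Field K] {n m : ℕ} (A : Matrix (Fin n) (Fin n) K)
    (h : m ≤ A.rank) :
    ∃ p q : Fin m ↪o Fin n, (A.submatrix p q).det ≠ 0 := by
  rw [Matrix.rank_eq_finrank_span_row] at h
  obtain ⟨p, hp⟩ := exists_orderEmbedding_linearIndependent A.row h
  have hB : (A.submatrix p id).rank = m := by
    have := LinearIndependent.rank_matrix (M := A.submatrix p id) hp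
    rwa [Fintype.card_fin] at this
  rw [Matrix.rank_eq_finrank_span_cols] at hB
  obtain ⟨q, hq⟩ := exists_orderEmbedding_linearIndependent _ hB.ge
  refine ⟨p, q, ?_⟩
  rw [← isUnit_iff_ne_zero, ← Matrix.isUnit_iff_isUnit_det,
    ← Matrix.linearIndependent_cols_iff_isUnit]
  exact hq

lemma minorIdeal_eq_top_of_le_rank {R : Type*} [CommRing R] {n m : ℕ}
    (A : Matrix (Fin n) (Fin n) R)
    (h : ∀ I : Ideal R, I.IsMaximal → m ≤ (A.map (Ideal.Quotient.mk I)).rank) :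
    minorIdeal m A = ⊤ := by
  by_contra hne
  obtain ⟨I, hI, hle⟩ := Ideal.exists_le_maximal _ hne
  let _ := Ideal.Quotient.field I
  obtain ⟨p, q, hpq⟩ := exists_det_submatrix_ne_zero (A.map (Ideal.Quotient.mk I)) (h I hI)
  refine hpq ?_
  rw [Matrix.submatrix_map, ← RingHom.mapMatrix_apply, ← RingHom.map_det,
    Ideal.Quotient.eq_zero_iff_mem]
  exact hle (Ideal.subset_span ⟨(p, q), rfl⟩)

/-- If a minor of size `m` of `A` is a unit, then every vector agrees, on the rows of the minor, with
a vector in the image of `A`. So the coordinate vectors outside these rows generate the cokernel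
of `A`. -/
lemma exists_mulVec_eq_on_minor_rows {R : Type*} [CommRing R] {n m : ℕ}
    (A : Matrix (Fin n) (Fin n) R) (p q : Fin m ↪o Fin n) (h : IsUnit (A.submatrix p q).det)
    (w : Fin n → R) : ∃ x, ∀ j, (A.mulVec x) (p j) = w (p j) := by
  classical
  -- The solution of the square system given by the minor, extended by zero.
  refine ⟨fun b => ∑ k, if q k = b then ((A.submatrix p q)⁻¹.mulVec (w ∘ p)) k else 0,
    fun j => ?_⟩
  have e : (A.submatrix p q).mulVec ((A.submatrix p q)⁻¹.mulVec (w ∘ p)) = w ∘ p := by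
    rw [Matrix.mulVec_mulVec, Matrix.mul_nonsing_inv _ h, Matrix.one_mulVec]
  have e' := congrFun e j
  rw [Function.comp_apply] at e'
  rw [← e', Matrix.mulVec, dotProduct]
  simp only [Finset.mul_sum]
  rw [Finset.sum_comm]
  simp [Matrix.mulVec, dotProduct]

/-! ### The matrix of the transition maps -/

/-- The matrix `T ^ k`, over a `ℤ[t]`-algebra `R`. -/
noncomputable def shiftPow (R : Type*) [CommRing R] [Algebra ℤ[X] R] (n k : ℕ) :
    Matrix (Fin n) (Fin n) R :=
  (shiftMatrix n ^ k).map (algebraMap ℤ[X] R)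

section Shift

variable {R S : Type*} [CommRing R] [Algebra ℤ[X] R] [CommRing S] [Algebra ℤ[X] S]

lemma shiftPow_add (n k l : ℕ) : shiftPow R n (k + l) = shiftPow R n k * shiftPow R n l := by
  rw [shiftPow, pow_add, Matrix.map_mul]
  rfl

lemma shiftPow_zero (n : ℕ) : shiftPow R n 0 = 1 := by
  rw [shiftPow, pow_zero, Matrix.map_one _ (map_zero _) (map_one _)]

lemma shiftPow_self (n : ℕ) :
    shiftPow R n n = algebraMap ℤ[X] R Polynomial.X • (1 : Matrix (Fin n) (Fin n) R) := by
  rw [shiftPow, shiftMatrix_pow_self]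
  ext a b
  simp [Matrix.one_apply, apply_ite (algebraMap ℤ[X] R)]

lemma shiftPow_map (f : R →ₐ[ℤ[X]] S) (n k : ℕ) :
    (shiftPow R n k).map f = shiftPow S n k := by
  ext a b
  simp [shiftPow]

lemma shiftPow_apply {n k : ℕ} (hk : k ≤ n) (a b : Fin n) :
    shiftPow R n k a b =
      if (b : ℕ) = a + k then 1
      else if (b : ℕ) + n = a + k then algebraMap ℤ[X] R Polynomial.X else 0 := by
  rw [shiftPow, Matrix.map_apply, shiftMatrix_pow n k hk]
  split_ifs <;> simp

/-- The columns of index at least `k` of `B T ^ k` are the first columns of `B`. -/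
lemma mul_shiftPow_apply_of_le {n k : ℕ} (hk : k ≤ n) (B : Matrix (Fin n) (Fin n) R)
    (a b c : Fin n) (h : (c : ℕ) + k = b) : (B * shiftPow R n k) a b = B a c := by
  have hb := b.2
  rw [Matrix.mul_apply, Finset.sum_eq_single c, shiftPow_apply hk, if_pos h.symm, mul_one]
  · intro e _ he
    have he' : (e : ℕ) ≠ c := fun h => he (Fin.ext h)
    rw [shiftPow_apply hk, if_neg (by omega), if_neg (by have := e.2; omega), mul_zero]
  · simp

/-- The first `k` columns of `B T ^ k` are `t` times the last `k` columns of `B`. -/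
lemma mul_shiftPow_apply_of_lt {n k : ℕ} (hk : k ≤ n) (B : Matrix (Fin n) (Fin n) R)
    (a b c : Fin n) (h : (c : ℕ) + k = b + n) :
    (B * shiftPow R n k) a b = algebraMap ℤ[X] R Polynomial.X * B a c := by
  have hb := b.2
  have hc := c.2
  rw [Matrix.mul_apply, Finset.sum_eq_single c, shiftPow_apply hk, if_neg (by omega),
    if_pos h.symm, mul_comm]
  · intro e _ he
    have he' : (e : ℕ) ≠ c := fun h => he (Fin.ext h)
    rw [shiftPow_apply hk, if_neg (by have := e.2; omega), if_neg (by omega), mul_zero]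
  · simp

lemma le_rank_shiftPow {K : Type*} [Field K] [Algebra ℤ[X] K] {n k : ℕ} (hk : k ≤ n) :
    n - k ≤ (shiftPow K n k).rank := by
  have h : (shiftPow K n k).submatrix (fun a : Fin (n - k) => (⟨a, by omega⟩ : Fin n))
      (fun a : Fin (n - k) => (⟨a + k, by omega⟩ : Fin n)) = 1 := by
    ext a b
    have ha := a.2
    have hb := b.2
    simp only [Matrix.submatrix_apply, shiftPow_apply hk, Matrix.one_apply, Fin.ext_iff]
    split_ifs <;> first | rfl | omega
  have := Matrix.rank_submatrix_le (shiftPow K n k)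
    (fun a : Fin (n - k) => (⟨a, by omega⟩ : Fin n))
    (fun a : Fin (n - k) => (⟨a + k, by omega⟩ : Fin n))
  rwa [h, Matrix.rank_one, Fintype.card_fin] at this

end Shift

/-! ### Cyclic products -/

section Cyclic

variable {N : ℕ} {M : Type*} [Monoid M]

/-- The product `A_i A_{i+1} ⋯ A_{i+k-1}`, with cyclic indices. The number `k` of factors is a natural
number, so that a product may go around the cycle. -/
def cyclicProd (A : Fin (N + 1) → M) : Fin (N + 1) → ℕ → M
  | _, 0 => 1
  | i, k + 1 => A i * cyclicProd A (i + 1) k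

lemma nsmul_one_fin (j : Fin (N + 1)) : (j : ℕ) • (1 : Fin (N + 1)) = j := by
  induction j using Fin.induction with
  | zero => simp
  | succ j ih =>
    rw [Fin.val_succ, succ_nsmul, ← Fin.val_castSucc, ih, Fin.coeSucc_eq_succ]

lemma prod_ofFn_nsmul (A : Fin (N + 1) → M) (i : Fin (N + 1)) (k : ℕ) :
    (List.ofFn fun j : Fin k => A (i + (j : ℕ) • 1)).prod = cyclicProd A i k := by
  induction k generalizing i with
  | zero => simp [cyclicProd]
  | succ k ih =>
    rw [List.ofFn_succ, List.prod_cons, cyclicProd, ← ih]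
    simp only [Fin.val_zero, zero_nsmul, add_zero, Fin.val_succ, succ_nsmul', add_assoc]

lemma prod_ofFn_eq_cyclicProd (A : Fin (N + 1) → M) (i : Fin (N + 1)) :
    (List.ofFn fun j : Fin (N + 1) => A (i + j)).prod = cyclicProd A i (N + 1) := by
  rw [← prod_ofFn_nsmul]
  simp only [nsmul_one_fin]

lemma cyclicProd_succ (A : Fin (N + 1) → M) (i : Fin (N + 1)) (k : ℕ) :
    cyclicProd A i (k + 1) = cyclicProd A i k * A (i + k • 1) := by
  induction k generalizing i with
  | zero => simp [cyclicProd]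
  | succ k ih =>
    rw [cyclicProd, ih, cyclicProd, mul_assoc, succ_nsmul', ← add_assoc]

lemma map_cyclicProd {M' : Type*} [Monoid M'] (f : M →* M') (A : Fin (N + 1) → M)
    (i : Fin (N + 1)) (k : ℕ) : f (cyclicProd A i k) = cyclicProd (fun j => f (A j)) i k := by
  induction k generalizing i with
  | zero => simp [cyclicProd]
  | succ k ih => rw [cyclicProd, map_mul, ih, cyclicProd]

end Cyclic

section SumCyclic

variable {N : ℕ} (d : Fin (N + 1) → ℕ)

lemma sum_range_cyclic (i : Fin (N + 1)) :
    ∑ j ∈ Finset.range (N + 1), d (i + j • 1) = dim d := by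
  rw [Finset.sum_range]
  simp only [nsmul_one_fin]
  exact Equiv.sum_comp (Equiv.addLeft i) d

lemma sum_range_cyclic_succ (i : Fin (N + 1)) :
    d i + ∑ j ∈ Finset.range N, d (i + 1 + j • 1) = dim d := by
  rw [← sum_range_cyclic d i, Finset.sum_range_succ', add_comm]
  simp only [zero_nsmul, add_zero, succ_nsmul', add_assoc]

lemma partialSum_le (i : Fin (N + 1)) : partialSum d i ≤ dim d :=
  Finset.sum_le_sum_of_subset (Finset.subset_univ _)

lemma le_dim (i : Fin (N + 1)) : d i ≤ dim d :=
  Finset.single_le_sum (fun _ _ => Nat.zero_le _) (Finset.mem_univ i)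

end SumCyclic

/-! ### Frames adapted to a cyclic system of matrices -/

section Chain

variable {N : ℕ} {d : Fin (N + 1) → ℕ} {n : ℕ} {R K : Type*} [CommRing R] [CommRing K]

/-- The column of index `c` of the frame at the position `i`: the vectors `v (i + 1) j`, for
`j < d_{i+1}`, are the last columns at `i`, and the column of index `c < n - d_{i+1}` is the image
under `A (i + 1)` of the column of index `c + d_{i+1}` at `i + 1`. The recursion ends because `c`
increases and remains below `n`. -/
def chainCol (hd : ∀ i, 0 < d i) (A : Fin (N + 1) → Matrix (Fin n) (Fin n) R)
    (v : Fin (N + 1) → ℕ → Fin n → R) (i : Fin (N + 1)) (c : ℕ) : Fin n → R :=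
  if c + d (i + 1) < n then (A (i + 1)).mulVec (chainCol hd A v (i + 1) (c + d (i + 1)))
  else v (i + 1) (c + d (i + 1) - n)
termination_by n - c
decreasing_by have := hd (i + 1); omega

variable (hd : ∀ i, 0 < d i) (A : Fin (N + 1) → Matrix (Fin n) (Fin n) R)
  (v : Fin (N + 1) → ℕ → Fin n → R)

lemma chainCol_of_lt {i : Fin (N + 1)} {c : ℕ} (h : c + d (i + 1) < n) :
    chainCol hd A v i c = (A (i + 1)).mulVec (chainCol hd A v (i + 1) (c + d (i + 1))) := by
  rw [chainCol, if_pos h]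

lemma chainCol_of_eq {i : Fin (N + 1)} {c j : ℕ} (h : c + d (i + 1) = n + j) :
    chainCol hd A v i c = v (i + 1) j := by
  rw [chainCol, if_neg (by omega), h, Nat.add_sub_cancel_left]

lemma chainCol_map (f : R →+* K) (i : Fin (N + 1)) (c : ℕ) :
    f ∘ chainCol hd A v i c =
      chainCol hd (fun i => (A i).map f) (fun i j => f ∘ v i j) i c := by
  induction hk : n - c using Nat.strong_induction_on generalizing i c with
  | _ k ih =>
    have hi := hd (i + 1)
    by_cases h : c + d (i + 1) < n
    · rw [chainCol_of_lt hd A v h, chainCol_of_lt hd _ _ h, ← ih _ (by omega) _ _ rfl]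
      ext a
      simp [RingHom.map_mulVec]
    · obtain ⟨j, hj⟩ := Nat.exists_eq_add_of_le (not_lt.1 h)
      rw [chainCol_of_eq hd A v hj, chainCol_of_eq hd _ _ hj]

/-- As long as `k ≤ N`, the indices met in `k` steps from `b < d i` are below
`d i + d_{i+1} + ⋯ + d_{i+k} ≤ n`, so the recursion for `chainCol` unfolds `k` times. -/
lemma chainCol_eq_cyclicProd_mulVec (hn : n = dim d) (i : Fin (N + 1)) {b k : ℕ} (hb : b < d i)
    (hk : k ≤ N) :
    chainCol hd A v i b = (cyclicProd A (i + 1) k).mulVec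
      (chainCol hd A v (i + k • 1) (b + ∑ j ∈ Finset.range k, d (i + 1 + j • 1))) := by
  induction k with
  | zero => simp [cyclicProd]
  | succ k ih =>
    have hle : ∑ j ∈ Finset.range (k + 1), d (i + 1 + j • 1) ≤
        ∑ j ∈ Finset.range N, d (i + 1 + j • 1) :=
      Finset.sum_le_sum_of_subset (Finset.range_subset_range.2 hk)
    have hsum := sum_range_cyclic_succ d i
    have hs := Finset.sum_range_succ (fun j => d (i + 1 + j • 1)) k
    have e : i + k • 1 + 1 = i + 1 + k • 1 := add_right_comm _ _ _
    have hlt : b + ∑ j ∈ Finset.range k, d (i + 1 + j • 1) + d (i + k • 1 + 1) < n := by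
      rw [e]; omega
    rw [ih (by omega), chainCol_of_lt hd A v hlt, Matrix.mulVec_mulVec, e, cyclicProd_succ, hs,
      succ_nsmul', ← add_assoc, add_assoc b]

/-- Going once around the cycle multiplies the vector `v i b` by the product of the `A j`. -/
lemma mulVec_chainCol (hn : n = dim d) (i : Fin (N + 1)) {b : ℕ} (hb : b < d i) :
    (A i).mulVec (chainCol hd A v i b) = (cyclicProd A i (N + 1)).mulVec (v i b) := by
  have e : i + N • 1 + 1 = i := by
    have h : (N + 1) • (1 : Fin (N + 1)) = 0 := by
      simpa using card_nsmul_eq_zero' (x := (1 : Fin (N + 1)))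
    rw [add_assoc, ← succ_nsmul, h, add_zero]
  have hsum := sum_range_cyclic_succ d i
  rw [chainCol_eq_cyclicProd_mulVec hd A v hn i hb le_rfl, chainCol_of_eq (j := b), e,
    Matrix.mulVec_mulVec, cyclicProd]
  rw [e]; omega

/-- The matrix whose columns are the vectors `chainCol`. -/
def chainMatrix (i : Fin (N + 1)) : Matrix (Fin n) (Fin n) R :=
  Matrix.of fun a c => chainCol hd A v i c a

lemma chainMatrix_map (f : R →+* K) (i : Fin (N + 1)) :
    (chainMatrix hd A v i).map f =
      chainMatrix hd (fun i => (A i).map f) (fun i j => f ∘ v i j) i := by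
  ext a c
  exact congrFun (chainCol_map hd A v f i c) a

lemma mul_chainMatrix_apply (i j : Fin (N + 1)) (a c : Fin n) :
    (A j * chainMatrix hd A v i) a c = (A j).mulVec (chainCol hd A v i c) a := rfl

/-- The matrices `chainMatrix` define a morphism from the standard system to the system `A`. -/
lemma mul_chainMatrix [Algebra ℤ[X] R] (hn : n = dim d)
    (hA : ∀ i, cyclicProd A i (N + 1) = algebraMap ℤ[X] R Polynomial.X • 1) (i : Fin (N + 1)) :
    A i * chainMatrix hd A v i = chainMatrix hd A v (i - 1) * shiftPow R n (d i) := by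
  have hdi : d i ≤ n := hn ▸ le_dim d i
  have e : i - 1 + 1 = i := sub_add_cancel i 1
  have hi := hd i
  ext a b
  have hb := b.2
  rw [mul_chainMatrix_apply]
  by_cases h : (b : ℕ) < d i
  · rw [mul_shiftPow_apply_of_lt hdi _ a b ⟨b + n - d i, by omega⟩ (by dsimp only; omega),
      mulVec_chainCol hd A v hn i h, hA, Matrix.smul_mulVec, Matrix.one_mulVec, chainMatrix,
      Matrix.of_apply, chainCol_of_eq (j := (b : ℕ)), e, Pi.smul_apply, smul_eq_mul]
    rw [e]; dsimp only; omega
  · rw [mul_shiftPow_apply_of_le hdi _ a b ⟨b - d i, by omega⟩ (by dsimp only; omega),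
      chainMatrix, Matrix.of_apply, chainCol_of_lt (i := i - 1), e]
    · rw [Nat.sub_add_cancel (not_lt.1 h)]
    · rw [e]; dsimp only; omega

/-- If the product of the `A i` around the cycle vanishes, and if the `v i j` generate the cokernel
of `A i`, then the vectors `chainCol` at each position generate. -/
lemma isUnit_det_chainMatrix (hn : n = dim d) (hA : ∀ i, cyclicProd A i (N + 1) = 0)
    (hv : ∀ i w, ∃ x, w - (A i).mulVec x ∈
      Submodule.span R (Set.range fun j : Fin (d i) => v i j)) (i : Fin (N + 1)) :
    IsUnit (chainMatrix hd A v i).det := by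
  let W : Fin (N + 1) → Submodule R (Fin n → R) := fun i =>
    LinearMap.range (chainMatrix hd A v i).mulVecLin
  have hW : ∀ i (c : Fin n), chainCol hd A v i c ∈ W i := fun i c =>
    ⟨Pi.single c 1, by
      rw [Matrix.mulVecLin_apply, Matrix.mulVec_single_one]; rfl⟩
  have hvW : ∀ i, Submodule.span R (Set.range fun j : Fin (d (i + 1)) => v (i + 1) j) ≤ W i := by
    intro i
    rw [Submodule.span_le]
    rintro _ ⟨j, rfl⟩
    have hj := j.2
    have hdi : d (i + 1) ≤ n := hn ▸ le_dim d (i + 1)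
    have := hW i ⟨n + j - d (i + 1), by omega⟩
    rwa [chainCol_of_eq (j := (j : ℕ))] at this
    dsimp only; omega
  have hAW : ∀ i w, w ∈ W (i + 1) → (A (i + 1)).mulVec w ∈ W i := by
    rintro i _ ⟨y, rfl⟩
    rw [Matrix.mulVecLin_apply, Matrix.mulVec_mulVec]
    have hmem : ∀ c : Fin n, (A (i + 1) * chainMatrix hd A v (i + 1)).col c ∈ W i := by
      intro c
      change (A (i + 1)).mulVec (chainCol hd A v (i + 1) c) ∈ W i
      by_cases h : (c : ℕ) < d (i + 1)
      · rw [mulVec_chainCol hd A v hn _ h, hA, Matrix.zero_mulVec]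
        exact zero_mem _
      · have := hW i ⟨c - d (i + 1), by omega⟩
        have hc := c.2
        rwa [chainCol_of_lt, Nat.sub_add_cancel (not_lt.1 h)] at this
        dsimp only; omega
    rw [Matrix.mulVec_eq_sum]
    exact sum_mem fun c _ => by
      rw [op_smul_eq_smul]
      exact Submodule.smul_mem _ _ (hmem c)
  -- The decomposition `x = A x' + u` of `hv`, iterated `k` times.
  have key : ∀ k i x, ∃ y, x - (cyclicProd A (i + 1) k).mulVec y ∈ W i := by
    intro k
    induction k with
    | zero => exact fun i x => ⟨x, by simp [cyclicProd]⟩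
    | succ k ih =>
      intro i x
      obtain ⟨x', hx'⟩ := hv (i + 1) x
      obtain ⟨y, hy⟩ := ih (i + 1) x'
      refine ⟨y, ?_⟩
      have := add_mem (hvW i hx') (hAW i _ hy)
      rwa [Matrix.mulVec_sub, Matrix.mulVec_mulVec, sub_add_sub_cancel] at this
  rw [← Matrix.isUnit_iff_isUnit_det, ← Matrix.mulVec_surjective_iff_isUnit]
  intro x
  obtain ⟨y, hy⟩ := key (N + 1) i x
  rwa [hA, Matrix.zero_mulVec, sub_zero] at hy

end Chain

section Frames

variable {N : ℕ} {d : Fin (N + 1) → ℕ} {R : Type*} [CommRing R] [Algebra ℤ[X] R]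

/-- Frames exist near the points where `t` does not vanish: all the `A i` and `T` are invertible
there. -/
lemma exists_frame_of_notMem (A : Fin (N + 1) → Matrix (Fin (dim d)) (Fin (dim d)) R)
    (hA : ∀ i, cyclicProd A i (N + 1) = algebraMap ℤ[X] R Polynomial.X • 1)
    (I : Ideal R) [I.IsPrime] (ht : algebraMap ℤ[X] R Polynomial.X ∉ I) :
    ∃ B : Fin (N + 1) → Matrix (Fin (dim d)) (Fin (dim d)) R,
      (∀ i, A i * B i = B (i - 1) * shiftPow R (dim d) (d i)) ∧ ∀ i, (B i).det ∉ I := by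
  -- Each of `A i` and `T ^ k` divides a scalar matrix `t`, hence has a determinant outside `I`.
  have hpow : ∀ C C' : Matrix (Fin (dim d)) (Fin (dim d)) R,
      C * C' = algebraMap ℤ[X] R Polynomial.X • 1 → C.det ∉ I ∧ C'.det ∉ I := by
    intro C C' h
    have hdet : C.det * C'.det ∉ I := by
      rw [← Matrix.det_mul, h, Matrix.det_smul, Matrix.det_one, mul_one]
      exact fun h' => ht (‹I.IsPrime›.mem_of_pow_mem _ h')
    exact ⟨fun h => hdet (I.mul_mem_right _ h), fun h => hdet (I.mul_mem_left _ h)⟩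
  have hAdet : ∀ i, (A i).det ∉ I := fun i => (hpow _ _ (hA i)).1
  have hcyc : ∀ k i, (cyclicProd A i k).det ∉ I := by
    intro k
    induction k with
    | zero =>
      intro i
      rw [cyclicProd, Matrix.det_one]
      exact fun h => ‹I.IsPrime›.ne_top (I.eq_top_iff_one.2 h)
    | succ k ih =>
      intro i h
      rw [cyclicProd, Matrix.det_mul] at h
      exact (‹I.IsPrime›.mem_or_mem h).elim (hAdet i) (ih _)
  have hshift : ∀ i, (shiftPow R (dim d) (partialSum d i)).det ∉ I := fun i =>
    (hpow _ (shiftPow R (dim d) (dim d - partialSum d i)) (by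
      rw [← shiftPow_add, Nat.add_sub_cancel' (partialSum_le d i), shiftPow_self])).1
  refine ⟨fun i => cyclicProd A (i + 1) (N + 1 - i) * shiftPow R (dim d) (partialSum d i),
    fun i => ?_, fun i h => ?_⟩
  · have e : i - 1 + 1 = i := sub_add_cancel i 1
    simp only [e]
    by_cases hi : i = 0
    · subst hi
      have h0 : (0 - 1 : Fin (N + 1)) = Fin.last N := by
        rw [zero_sub, eq_comm, eq_neg_iff_add_eq_zero, Fin.last_add_one]
      have hp0 : partialSum d 0 = 0 := by simp [partialSum]
      have h1 : N + 1 - N = 1 := by omega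
      rw [h0, mul_assoc, ← shiftPow_add, partialSum_last_add, shiftPow_self, hp0, shiftPow_zero,
        Fin.val_zero, Nat.sub_zero, hA, Fin.val_last, h1]
      simp [cyclicProd]
    · have hv : ((i - 1 : Fin (N + 1)) : ℕ) = i - 1 := Fin.val_sub_one_of_ne_zero hi
      have hi' : (i : ℕ) ≠ 0 := fun e => hi (Fin.ext e)
      have h1 : N + 1 - ((i : ℕ) - 1) = (N + 1 - i) + 1 := by omega
      rw [hv, h1, mul_assoc, ← shiftPow_add, ← partialSum_sub_one d i hi, cyclicProd, mul_assoc]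
  · rw [Matrix.det_mul] at h
    exact (‹I.IsPrime›.mem_or_mem h).elim (hcyc _ _) (hshift i)

/-- Frames exist near the points where `t` vanishes: there, a frame is given by `chainMatrix`, for
coordinate vectors that generate the cokernels of the `A i` modulo `I`. -/
lemma exists_frame_of_mem (hd : ∀ i, 0 < d i)
    (A : Fin (N + 1) → Matrix (Fin (dim d)) (Fin (dim d)) R)
    (hA : ∀ i, cyclicProd A i (N + 1) = algebraMap ℤ[X] R Polynomial.X • 1)
    (hmin : ∀ i, minorIdeal (dim d - d i) (A i) = ⊤)
    (I : Ideal R) [I.IsMaximal] (ht : algebraMap ℤ[X] R Polynomial.X ∈ I) :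
    ∃ B : Fin (N + 1) → Matrix (Fin (dim d)) (Fin (dim d)) R,
      (∀ i, A i * B i = B (i - 1) * shiftPow R (dim d) (d i)) ∧ ∀ i, (B i).det ∉ I := by
  classical
  let _ := Ideal.Quotient.field I
  let f := Ideal.Quotient.mk I
  have hpq : ∀ i, ∃ p q : Fin (dim d - d i) ↪o Fin (dim d),
      ((A i).submatrix p q).det ∉ I := by
    intro i
    by_contra! h
    refine ‹I.IsMaximal›.ne_top (top_le_iff.1 ((hmin i).ge.trans (Ideal.span_le.2 ?_)))
    rintro _ ⟨⟨p, q⟩, rfl⟩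
    exact h p q
  choose p q hpq using hpq
  -- An enumeration of the rows that do not occur in the chosen minor.
  have hσ : ∀ i, ∃ σ : Fin (d i) → Fin (dim d), ∀ c, c ∉ Set.range (p i) → c ∈ Set.range σ := by
    intro i
    have hcard : (Finset.univ.image (p i))ᶜ.card = d i := by
      rw [Finset.card_compl, Finset.card_image_of_injective _ (p i).injective, Finset.card_univ,
        Fintype.card_fin, Fintype.card_fin]
      have := le_dim d i
      omega
    refine ⟨Finset.orderEmbOfFin _ hcard, fun c hc => ?_⟩
    rw [Finset.range_orderEmbOfFin]
    simpa using hc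
  choose σ hσ using hσ
  let v : Fin (N + 1) → ℕ → Fin (dim d) → R := fun i j =>
    if h : j < d i then Pi.single (σ i ⟨j, h⟩) 1 else 0
  refine ⟨chainMatrix hd A v, mul_chainMatrix hd A v rfl hA, fun i h => ?_⟩
  have hunit : IsUnit (chainMatrix hd (fun i => (A i).map f) (fun i j => f ∘ v i j) i).det := by
    refine isUnit_det_chainMatrix hd _ _ rfl (fun i => ?_) (fun i w => ?_) i
    · have := map_cyclicProd (f.mapMatrix (m := Fin (dim d))).toMonoidHom A i (N + 1)
      rw [hA] at this
      refine this.symm.trans ?_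
      ext a b
      change f (algebraMap ℤ[X] R Polynomial.X * (1 : Matrix _ _ R) a b) = 0
      rw [map_mul, Ideal.Quotient.eq_zero_iff_mem.2 ht, zero_mul]
    · have hu : IsUnit (((A i).map f).submatrix (p i) (q i)).det := by
        rw [isUnit_iff_ne_zero, Matrix.submatrix_map, ← RingHom.mapMatrix_apply,
          ← RingHom.map_det, Ne, Ideal.Quotient.eq_zero_iff_mem]
        exact hpq i
      obtain ⟨x, hx⟩ := exists_mulVec_eq_on_minor_rows _ (p i) (q i) hu w
      refine ⟨x, ?_⟩
      rw [pi_eq_sum_univ (w - _)]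
      refine sum_mem fun c _ => ?_
      by_cases hc : c ∈ Set.range (p i)
      · obtain ⟨j, rfl⟩ := hc
        rw [Pi.sub_apply, hx, sub_self, zero_smul]
        exact zero_mem _
      · obtain ⟨j, rfl⟩ := hσ i c hc
        refine Submodule.smul_mem _ _ (Submodule.subset_span ⟨j, ?_⟩)
        ext b
        simp [v, Pi.single_apply, eq_comm, apply_ite f]
  rw [← chainMatrix_map, ← RingHom.mapMatrix_apply, ← RingHom.map_det] at hunit
  exact hunit.ne_zero (Ideal.Quotient.eq_zero_iff_mem.2 h)

lemma exists_frame (hd : ∀ i, 0 < d i)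
    (A : Fin (N + 1) → Matrix (Fin (dim d)) (Fin (dim d)) R)
    (hA : ∀ i, cyclicProd A i (N + 1) = algebraMap ℤ[X] R Polynomial.X • 1)
    (hmin : ∀ i, minorIdeal (dim d - d i) (A i) = ⊤) (I : Ideal R) [I.IsMaximal] :
    ∃ B : Fin (N + 1) → Matrix (Fin (dim d)) (Fin (dim d)) R,
      (∀ i, A i * B i = B (i - 1) * shiftPow R (dim d) (d i)) ∧ ∀ i, (B i).det ∉ I := by
  by_cases ht : algebraMap ℤ[X] R Polynomial.X ∈ I
  · exact exists_frame_of_mem hd A hA hmin I ht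
  · exact exists_frame_of_notMem A hA I ht

end Frames

/-! ### Matrices of systems with a frame -/

section FrameMatrix

variable {N : ℕ} {d : Fin (N + 1) → ℕ} {R : Type*} [CommRing R] [Algebra ℤ[X] R]
  {A B : Fin (N + 1) → Matrix (Fin (dim d)) (Fin (dim d)) R}

lemma cyclicProd_mul_frame (hAB : ∀ i, A i * B i = B (i - 1) * shiftPow R (dim d) (d i))
    (i : Fin (N + 1)) (k : ℕ) :
    cyclicProd A (i + 1) k * B (i + k • 1) =
      B i * shiftPow R (dim d) (∑ j ∈ Finset.range k, d (i + 1 + j • 1)) := by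
  induction k with
  | zero => simp [cyclicProd, shiftPow_zero]
  | succ k ih =>
    have e : i + (k + 1) • 1 - 1 = i + k • 1 := by rw [succ_nsmul, ← add_assoc, add_sub_cancel_right]
    have e' : i + 1 + k • 1 = i + (k + 1) • 1 := by rw [succ_nsmul', ← add_assoc]
    rw [cyclicProd_succ, mul_assoc, e', hAB, e, ← mul_assoc, ih, Finset.sum_range_succ,
      shiftPow_add, ← mul_assoc, e']

lemma cyclicProd_eq_of_frame (hAB : ∀ i, A i * B i = B (i - 1) * shiftPow R (dim d) (d i))
    (hB : ∀ i, IsUnit (B i).det) (i : Fin (N + 1)) :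
    cyclicProd A i (N + 1) = algebraMap ℤ[X] R Polynomial.X • 1 := by
  have h := cyclicProd_mul_frame hAB (i - 1) (N + 1)
  have h0 : (N + 1) • (1 : Fin (N + 1)) = 0 := by
    simpa using card_nsmul_eq_zero' (x := (1 : Fin (N + 1)))
  rw [h0, add_zero, sub_add_cancel, sum_range_cyclic, shiftPow_self, mul_smul_comm, mul_one] at h
  refine ((Matrix.isUnit_iff_isUnit_det _).2 (hB (i - 1))).mul_right_cancel ?_
  rw [h, smul_one_mul]

lemma minorIdeal_eq_top_of_frame (hAB : ∀ i, A i * B i = B (i - 1) * shiftPow R (dim d) (d i))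
    (hB : ∀ i, IsUnit (B i).det) (i : Fin (N + 1)) : minorIdeal (dim d - d i) (A i) = ⊤ := by
  refine minorIdeal_eq_top_of_le_rank _ fun I hI => ?_
  let _ := Ideal.Quotient.field I
  have hB' : ∀ i, IsUnit ((B i).map (Ideal.Quotient.mk I)).det := fun i => by
    rw [← RingHom.mapMatrix_apply, ← RingHom.map_det]
    exact (hB i).map _
  have h := congrArg (fun C => C.map (Ideal.Quotient.mk I)) (hAB i)
  simp only [Matrix.map_mul] at h
  have hs : (shiftPow R (dim d) (d i)).map (Ideal.Quotient.mk I) =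
      shiftPow (R ⧸ I) (dim d) (d i) := shiftPow_map (Ideal.Quotient.mkₐ ℤ[X] I) _ _
  rw [← Matrix.rank_mul_eq_left_of_isUnit_det _ _ (hB' i), h,
    Matrix.rank_mul_eq_right_of_isUnit_det _ _ (hB' _), hs]
  exact le_rank_shiftPow (le_dim d i)

end FrameMatrix

lemma span_entries_eq_top_of_minorIdeal {R : Type*} [CommRing R] {n m : ℕ} (hm : 0 < m)
    (A : Matrix (Fin n) (Fin n) R) (h : minorIdeal m A = ⊤) :
    Ideal.span (Set.range fun p : Fin n × Fin n => A p.1 p.2) = ⊤ := by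
  refine top_le_iff.1 (h.ge.trans (Ideal.span_le.2 ?_))
  rintro _ ⟨⟨p, q⟩, rfl⟩
  have : Nonempty (Fin m) := ⟨⟨0, hm⟩⟩
  rw [SetLike.mem_coe, ← Ideal.Quotient.eq_zero_iff_mem, RingHom.map_det]
  refine (congrArg Matrix.det (Matrix.ext fun a b => ?_)).trans Matrix.det_zero
  exact Ideal.Quotient.eq_zero_iff_mem.2 (Ideal.subset_span ⟨(p a, q b), rfl⟩)

/-! ### Bases of the lattices -/

section Lattice

variable {N : ℕ} (d : Fin (N + 1) → ℕ)

lemma shiftMatrix_pow_mulVec_injective {n k : ℕ} (hk : k ≤ n) :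
    Function.Injective (shiftMatrix n ^ k).mulVecLin := by
  intro v w h
  have h' := congrArg (shiftMatrix n ^ (n - k)).mulVec h
  simp only [Matrix.mulVecLin_apply, Matrix.mulVec_mulVec, ← pow_add, Nat.sub_add_cancel hk,
    shiftMatrix_pow_self, Matrix.smul_mulVec, Matrix.one_mulVec] at h'
  exact smul_right_injective _ Polynomial.X_ne_zero h'

/-- The isomorphism `T ^ (d_1 + ⋯ + d_i)` from `ℤ[t]ⁿ` to `𝒱_i`. -/
noncomputable def latticeEquiv (i : Fin (N + 1)) : (Fin (dim d) → ℤ[X]) ≃ₗ[ℤ[X]] lattice d i :=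
  LinearEquiv.ofInjective _ (shiftMatrix_pow_mulVec_injective (partialSum_le d i))

lemma coe_latticeEquiv (i : Fin (N + 1)) (w : Fin (dim d) → ℤ[X]) :
    (latticeEquiv d i w : Fin (dim d) → ℤ[X]) =
      (shiftMatrix (dim d) ^ partialSum d i).mulVec w := rfl

/-- In terms of the isomorphisms of `𝒱_i` with `ℤ[t]ⁿ`, all the maps `α_i` are given by `T ^ d_i`; for
`i = 0` this is the identity `t = T ^ n`. -/
lemma latticeMap_latticeEquiv (i : Fin (N + 1)) (w : Fin (dim d) → ℤ[X]) :
    latticeMap d i (latticeEquiv d i w) =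
      latticeEquiv d (i - 1) ((shiftMatrix (dim d) ^ d i).mulVec w) := by
  refine Subtype.ext ?_
  rw [latticeMap, LinearMap.coe_restrict_apply, coe_latticeEquiv, coe_latticeEquiv,
    Matrix.mulVec_mulVec, ← pow_add]
  by_cases hi : i = 0
  · subst hi
    have h0 : (0 - 1 : Fin (N + 1)) = Fin.last N := by
      rw [zero_sub, eq_comm, eq_neg_iff_add_eq_zero, Fin.last_add_one]
    have hp : partialSum d 0 = 0 := by simp [partialSum]
    rw [h0, partialSum_last_add, shiftMatrix_pow_self, hp]
    simp [scaling, Matrix.smul_mulVec]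
  · rw [← partialSum_sub_one d i hi]
    simp [scaling, hi]

/-- The basis of `𝒱_i` that is the image of the standard basis under `T ^ (d_1 + ⋯ + d_i)`. -/
noncomputable def latticeBasis (i : Fin (N + 1)) :
    Module.Basis (Fin (dim d)) ℤ[X] (lattice d i) :=
  (Pi.basisFun ℤ[X] _).map (latticeEquiv d i)

lemma toMatrix_latticeMap (i : Fin (N + 1)) :
    LinearMap.toMatrix (latticeBasis d i) (latticeBasis d (i - 1)) (latticeMap d i) =
      shiftMatrix (dim d) ^ d i := by
  ext a b
  rw [LinearMap.toMatrix_apply, latticeBasis, latticeBasis, Module.Basis.map_apply,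
    latticeMap_latticeEquiv, Module.Basis.map_repr]
  simp

variable (R : Type*) [CommRing R] [Algebra ℤ[X] R]

lemma toMatrix_latticeMap_baseChange (i : Fin (N + 1)) :
    LinearMap.toMatrix (Algebra.TensorProduct.basis R (latticeBasis d i))
      (Algebra.TensorProduct.basis R (latticeBasis d (i - 1))) ((latticeMap d i).baseChange R) =
      shiftPow R (dim d) (d i) := by
  rw [LinearMap.toMatrix_baseChange, toMatrix_latticeMap, shiftPow]

end Lattice

/-! ### The standard direct factor -/

section StdSub

variable {R : Type u} [CommRing R] [Algebra ℤ[X] R]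

/-- The standard basis of `V ⊗ R`. -/
noncomputable abbrev stdBasis (R : Type u) [CommRing R] [Algebra ℤ[X] R] (n : ℕ) :
    Module.Basis (Fin n) R (R ⊗[ℤ[X]] (Fin n → ℤ[X])) :=
  Algebra.TensorProduct.basis R (Pi.basisFun ℤ[X] (Fin n))

lemma stdSub_baseChange_eq_span (r n : ℕ) :
    (stdSub r n).baseChange R = Submodule.span R (stdBasis R n '' {a | (a : ℕ) < r}) := by
  refine le_antisymm ?_ (Submodule.span_le.2 ?_)
  · rw [Submodule.baseChange_eq_span, Submodule.span_le]
    rintro _ ⟨v, hv, rfl⟩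
    rw [SetLike.mem_coe, ← (stdBasis R n).sum_repr (TensorProduct.mk ℤ[X] R (Fin n → ℤ[X]) 1 v)]
    refine sum_mem fun a _ => ?_
    by_cases ha : (a : ℕ) < r
    · exact Submodule.smul_mem _ _ (Submodule.subset_span ⟨a, ha, rfl⟩)
    · have : v a = 0 := hv a (not_lt.1 ha)
      simp [this]
  · rintro _ ⟨a, ha, rfl⟩
    rw [Algebra.TensorProduct.basis_apply]
    refine Submodule.tmul_mem_baseChange_of_mem _ fun b hb => ?_
    have : b ≠ a := fun e => absurd ha (by rw [← e]; exact not_lt.2 hb)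
    simp [this]

lemma mem_stdSub_baseChange {r n : ℕ} {x : R ⊗[ℤ[X]] (Fin n → ℤ[X])} :
    x ∈ (stdSub r n).baseChange R ↔ ∀ a : Fin n, r ≤ a → (stdBasis R n).repr x a = 0 := by
  rw [stdSub_baseChange_eq_span, Module.Basis.mem_span_image]
  refine ⟨fun h a ha => ?_, fun h a ha => ?_⟩
  · by_contra hne
    exact absurd (h (Finsupp.mem_support_iff.2 hne)) (not_lt.2 ha)
  · by_contra hlt
    exact Finsupp.mem_support_iff.1 ha (h a (not_lt.1 hlt))

lemma map_stdSub_le_iff {r n : ℕ}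
    (f : R ⊗[ℤ[X]] (Fin n → ℤ[X]) →ₗ[R] R ⊗[ℤ[X]] (Fin n → ℤ[X])) :
    ((stdSub r n).baseChange R).map f ≤ (stdSub r n).baseChange R ↔
      ∀ a b : Fin n, r ≤ a → (b : ℕ) < r →
        LinearMap.toMatrix (stdBasis R n) (stdBasis R n) f a b = 0 := by
  conv_lhs => lhs; rw [stdSub_baseChange_eq_span]
  rw [Submodule.map_span, Submodule.span_le]
  simp only [LinearMap.toMatrix_apply]
  refine ⟨fun h a b ha hb => ?_, fun h => ?_⟩
  · exact mem_stdSub_baseChange.1 (h ⟨_, ⟨b, hb, rfl⟩, rfl⟩) a ha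
  · rintro _ ⟨_, ⟨b, hb, rfl⟩, rfl⟩
    exact mem_stdSub_baseChange.2 fun a ha => h a b ha hb

lemma isDirectFactor_stdSub {r n : ℕ} (hr : r ≤ n) :
    IsDirectFactor r ((stdSub r n).baseChange R) := by
  rw [stdSub_baseChange_eq_span]
  refine ⟨⟨Submodule.span R (stdBasis R n '' {a | (a : ℕ) < r}ᶜ), ?_, ?_⟩, fun p => ?_⟩
  · exact (stdBasis R n).linearIndependent.disjoint_span_image disjoint_compl_right
  · rw [codisjoint_iff, ← Submodule.span_union, ← Set.image_union, Set.union_compl_self,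
      Set.image_univ, Module.Basis.span_eq]
  · have : Nontrivial R := ⟨0, 1, fun h => p.2.ne_top ((Ideal.eq_top_iff_one _).2 (h ▸ zero_mem _))⟩
    have hli : LinearIndependent R fun a : {a : Fin n | (a : ℕ) < r} => stdBasis R n a :=
      (stdBasis R n).linearIndependent.comp _ Subtype.val_injective
    have himg : stdBasis R n '' {a | (a : ℕ) < r} =
        Set.range fun a : {a : Fin n | (a : ℕ) < r} => stdBasis R n a :=
      Set.image_eq_range _ _
    rw [himg]
    have := Module.Free.of_basis (Module.Basis.span hli)
    have := Module.Finite.of_basis (Module.Basis.span hli)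
    rw [Module.rankAtStalk_eq_finrank_of_free, Pi.natCast_apply, Nat.cast_id,
      Module.finrank_eq_card_basis (Module.Basis.span hli)]
    have e : Fin r ≃ {a : Fin n | (a : ℕ) < r} :=
      { toFun := fun a => ⟨Fin.castLE hr a, a.2⟩
        invFun := fun a => ⟨a.1, a.2⟩
        left_inv := fun _ => rfl
        right_inv := fun _ => rfl }
    rw [← Fintype.card_congr e, Fintype.card_fin]

end StdSub

/-! ### Rigidifications and frames -/

section Rigidification

variable {N : ℕ} {r : ℕ} {d : Fin (N + 1) → ℕ} {R S : Type u} [CommRing R] [CommRing S]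
  [Algebra ℤ[X] R] [Algebra ℤ[X] S]

/-- The basis of `𝒱_i ⊗ R` deduced from `latticeBasis`. -/
noncomputable abbrev latticeBasisChange (d : Fin (N + 1) → ℕ) (R : Type u) [CommRing R]
    [Algebra ℤ[X] R] (i : Fin (N + 1)) :
    Module.Basis (Fin (dim d)) R (R ⊗[ℤ[X]] lattice d i) :=
  Algebra.TensorProduct.basis R (latticeBasis d i)

/-- The endomorphism `φ_{i-1} α_i φ_i⁻¹` of `V ⊗ R`. -/
noncomputable def transitionMap
    (φ : ∀ i, (R ⊗[ℤ[X]] lattice d i) ≃ₗ[R] (R ⊗[ℤ[X]] (Fin (dim d) → ℤ[X])))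
    (i : Fin (N + 1)) :
    R ⊗[ℤ[X]] (Fin (dim d) → ℤ[X]) →ₗ[R] R ⊗[ℤ[X]] (Fin (dim d) → ℤ[X]) :=
  (φ (i - 1)).toLinearMap ∘ₗ (latticeMap d i).baseChange R ∘ₗ (φ i).symm.toLinearMap

lemma transitionMap_apply
    (φ : ∀ i, (R ⊗[ℤ[X]] lattice d i) ≃ₗ[R] (R ⊗[ℤ[X]] (Fin (dim d) → ℤ[X])))
    (i : Fin (N + 1)) (x : R ⊗[ℤ[X]] lattice d i) :
    transitionMap φ i (φ i x) = φ (i - 1) ((latticeMap d i).baseChange R x) := by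
  simp [transitionMap]

lemma RigLocalModel.transition_eq (x : RigLocalModel r d R) (i : Fin (N + 1)) :
    x.transition i =
      LinearMap.toMatrix (stdBasis R (dim d)) (stdBasis R (dim d)) (transitionMap x.φ i) := rfl

/-- The matrix of a rigidification `φ_i` in the basis `latticeBasisChange`. -/
noncomputable def rigMatrix
    (φ : ∀ i, (R ⊗[ℤ[X]] lattice d i) ≃ₗ[R] (R ⊗[ℤ[X]] (Fin (dim d) → ℤ[X])))
    (i : Fin (N + 1)) : Matrix (Fin (dim d)) (Fin (dim d)) R :=
  LinearMap.toMatrix (latticeBasisChange d R i) (stdBasis R (dim d)) (φ i).toLinearMap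

lemma isUnit_det_rigMatrix
    (φ : ∀ i, (R ⊗[ℤ[X]] lattice d i) ≃ₗ[R] (R ⊗[ℤ[X]] (Fin (dim d) → ℤ[X])))
    (i : Fin (N + 1)) : IsUnit (rigMatrix φ i).det :=
  LinearEquiv.isUnit_det _ _ _

lemma toMatrix_transitionMap_mul
    (φ : ∀ i, (R ⊗[ℤ[X]] lattice d i) ≃ₗ[R] (R ⊗[ℤ[X]] (Fin (dim d) → ℤ[X])))
    (i : Fin (N + 1)) :
    LinearMap.toMatrix (stdBasis R (dim d)) (stdBasis R (dim d)) (transitionMap φ i) *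
      rigMatrix φ i = rigMatrix φ (i - 1) * shiftPow R (dim d) (d i) := by
  rw [rigMatrix, rigMatrix, ← toMatrix_latticeMap_baseChange, ← LinearMap.toMatrix_comp,
    ← LinearMap.toMatrix_comp]
  exact congrArg _ (LinearMap.ext fun x => transitionMap_apply φ i x)

lemma transitionMap_map_le (x : RigLocalModel r d R) (i : Fin (N + 1)) :
    ((stdSub r (dim d)).baseChange R).map (transitionMap x.φ i) ≤
      (stdSub r (dim d)).baseChange R := by
  conv_lhs => rw [← x.map_φ i]
  rw [← x.map_φ (i - 1)]
  rintro _ ⟨_, ⟨w, hw, rfl⟩, rfl⟩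
  exact ⟨_, x.map_le i ⟨w, hw, rfl⟩, (transitionMap_apply x.φ i w).symm⟩

/-- The hypothesis `1 ≤ N` makes every `d i` smaller than `n`. -/
lemma dim_sub_pos (hN : 1 ≤ N) (hd : ∀ i, 0 < d i) (i : Fin (N + 1)) : 0 < dim d - d i := by
  have h := sum_range_cyclic_succ d i
  have h0 : d (i + 1 + 0 • 1) ≤ ∑ j ∈ Finset.range N, d (i + 1 + j • 1) :=
    Finset.single_le_sum (f := fun j => d (i + 1 + j • 1)) (fun _ _ => Nat.zero_le _)
      (Finset.mem_range.2 hN)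
  have := hd (i + 1 + 0 • 1)
  omega

lemma RigLocalModel.minorIdeal_transition (x : RigLocalModel r d R) (i : Fin (N + 1)) :
    minorIdeal (dim d - d i) (x.transition i) = ⊤ :=
  minorIdeal_eq_top_of_frame (toMatrix_transitionMap_mul x.φ) (isUnit_det_rigMatrix x.φ) i

lemma RigLocalModel.isMu_transition (hN : 1 ≤ N) (hd : ∀ i, 0 < d i) (x : RigLocalModel r d R) :
    IsMu r (dim d) N x.transition where
  mem_lie i a b ha hb := (map_stdSub_le_iff _).1 (transitionMap_map_le x i) a b ha hb
  rank_ge_one i :=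
    span_entries_eq_top_of_minorIdeal (dim_sub_pos hN hd i) _ (x.minorIdeal_transition i)
  prod_eq i := by
    rw [prod_ofFn_eq_cyclicProd]
    exact cyclicProd_eq_of_frame (toMatrix_transitionMap_mul x.φ) (isUnit_det_rigMatrix x.φ) i

lemma repr_extScalars {ι M : Type} [AddCommGroup M] [Module ℤ[X] M]
    (b : Module.Basis ι ℤ[X] M) (f : R →ₐ[ℤ[X]] S) (x : R ⊗[ℤ[X]] M) (i : ι) :
    (Algebra.TensorProduct.basis S b).repr (extScalars f M x) i =
      f ((Algebra.TensorProduct.basis R b).repr x i) := by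
  induction x with
  | zero => simp
  | tmul a m => simp
  | add x y hx hy => simp only [map_add, Finsupp.add_apply, hx, hy]

lemma toMatrix_push {n : ℕ} {M M' : Type} [AddCommGroup M] [Module ℤ[X] M] [AddCommGroup M']
    [Module ℤ[X] M'] (b : Module.Basis (Fin n) ℤ[X] M) (b' : Module.Basis (Fin n) ℤ[X] M')
    (f : R →ₐ[ℤ[X]] S) (h : R ⊗[ℤ[X]] M →ₗ[R] R ⊗[ℤ[X]] M') :
    LinearMap.toMatrix (Algebra.TensorProduct.basis S b) (Algebra.TensorProduct.basis S b')
      (push f h) = (LinearMap.toMatrix (Algebra.TensorProduct.basis R b)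
        (Algebra.TensorProduct.basis R b') h).map f := by
  ext i j
  rw [Matrix.map_apply, LinearMap.toMatrix_apply, LinearMap.toMatrix_apply, ← repr_extScalars,
    Algebra.TensorProduct.basis_apply, Algebra.TensorProduct.basis_apply, push_tmul, one_smul]

lemma RigLocalModel.transition_map (f : R →ₐ[ℤ[X]] S) (x : RigLocalModel r d R)
    (i : Fin (N + 1)) : (x.map f).transition i = (x.transition i).map f := by
  rw [transition_eq, transition_eq, ← toMatrix_push]
  congr 1
  rw [transitionMap, transitionMap, push_comp, push_comp, push_baseChange]
  rfl

lemma RigLocalModel.transition_smul (g : autGroup d R) (x : RigLocalModel r d R)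
    (i : Fin (N + 1)) : (x.smul g).transition i = x.transition i := by
  rw [transition_eq, transition_eq]
  congr 1
  refine LinearMap.ext fun v => ?_
  obtain ⟨w, rfl⟩ := ((x.smul g).φ i).surjective v
  obtain ⟨w, rfl⟩ := (g.1 i).surjective w
  have h : ∀ j y, (x.smul g).φ j (g.1 j y) = x.φ j y := fun j y =>
    congrArg (x.φ j) ((g.1 j).symm_apply_apply y)
  rw [transitionMap_apply, ← mem_autGroup.1 g.2 i w, h, h, transitionMap_apply]

/-- Two rigidified points with the same transition matrices differ by the automorphism
`y.φ⁻¹ ∘ x.φ` of the system, and by no other. -/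
lemma RigLocalModel.existsUnique_smul_eq (x y : RigLocalModel r d R)
    (h : ∀ i, x.transition i = y.transition i) : ∃! g : autGroup d R, x.smul g = y := by
  have h' : ∀ i, transitionMap x.φ i = transitionMap y.φ i := fun i =>
    (LinearMap.toMatrix _ _).injective (h i)
  refine ⟨⟨fun i => (x.φ i).trans (y.φ i).symm, mem_autGroup.2 fun i v => ?_⟩, ?_, fun g hg => ?_⟩
  · refine (y.φ (i - 1)).injective ?_
    rw [← transitionMap_apply, LinearEquiv.trans_apply, LinearEquiv.trans_apply,
      LinearEquiv.apply_symm_apply, LinearEquiv.apply_symm_apply, ← h', transitionMap_apply]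
  · refine RigLocalModel.ext' (fun i => ?_) fun i => LinearMap.ext fun v => ?_
    · refine Submodule.map_injective_of_injective (y.φ i).injective ?_
      refine Eq.trans ?_ (y.map_φ i).symm
      rw [← x.map_φ i, smul, ← Submodule.map_comp]
      congr 1
      exact LinearMap.ext fun v => (y.φ i).apply_symm_apply (x.φ i v)
    · change x.φ i ((x.φ i).symm (y.φ i v)) = y.φ i v
      exact (x.φ i).apply_symm_apply _
  · refine autGroup_ext fun i => LinearMap.ext fun v => ?_
    refine (y.φ i).injective ?_
    subst hg
    change x.φ i ((g.1 i).symm (g.1 i v)) = (x.smul g).φ i (((x.smul g).φ i).symm (x.φ i v))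
    rw [LinearEquiv.symm_apply_apply, LinearEquiv.apply_symm_apply]

lemma exists_rigMatrix_eq {B : Fin (N + 1) → Matrix (Fin (dim d)) (Fin (dim d)) R}
    (hB : ∀ i, IsUnit (B i).det) :
    ∃ φ : ∀ i, (R ⊗[ℤ[X]] lattice d i) ≃ₗ[R] (R ⊗[ℤ[X]] (Fin (dim d) → ℤ[X])),
      ∀ i, rigMatrix φ i = B i := by
  have h : ∀ i, IsUnit (LinearMap.toMatrix (latticeBasisChange d R i) (stdBasis R (dim d))
      (Matrix.toLin (latticeBasisChange d R i) (stdBasis R (dim d)) (B i))).det := fun i => by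
    rw [LinearMap.toMatrix_toLin]; exact hB i
  refine ⟨fun i => LinearEquiv.ofIsUnitDet (h i), fun i => ?_⟩
  exact LinearMap.toMatrix_toLin _ _ (B i)

/-- A frame of the system `A` yields a rigidified point with transition matrices `A`: the
isomorphisms `φ_i` have the matrices `B i`, and `ω_i` is the inverse image of `Ω`. -/
lemma exists_transition_eq_of_frame (hr : r ≤ dim d)
    {A B : Fin (N + 1) → Matrix (Fin (dim d)) (Fin (dim d)) R}
    (hlie : ∀ i (a b : Fin (dim d)), r ≤ a → (b : ℕ) < r → A i a b = 0)
    (hAB : ∀ i, A i * B i = B (i - 1) * shiftPow R (dim d) (d i)) (hB : ∀ i, IsUnit (B i).det) :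
    ∃ x : RigLocalModel r d R, ∀ i, x.transition i = A i := by
  obtain ⟨φ, hφ⟩ := exists_rigMatrix_eq hB
  have hA : ∀ i, LinearMap.toMatrix (stdBasis R (dim d)) (stdBasis R (dim d))
      (transitionMap φ i) = A i := fun i => by
    refine ((Matrix.isUnit_iff_isUnit_det _).2 (hB i)).mul_right_cancel ?_
    rw [hAB i, ← hφ i, ← hφ (i - 1), toMatrix_transitionMap_mul]
  let x : RigLocalModel r d R :=
    { ω := fun i => ((stdSub r (dim d)).baseChange R).map (φ i).symm.toLinearMap
      isDirectFactor := fun i => (isDirectFactor_stdSub hr).map_equiv _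
      map_le := fun i => by
        rintro _ ⟨_, ⟨v, hv, rfl⟩, rfl⟩
        have hle := (map_stdSub_le_iff (R := R) (r := r) (transitionMap φ i)).2
          fun a b ha hb => (congrFun (congrFun (hA i) a) b).trans (hlie i a b ha hb)
        exact ⟨transitionMap φ i v, hle ⟨v, hv, rfl⟩, by simp [transitionMap]⟩
      φ := φ
      map_φ := fun i => by
        rw [← Submodule.map_comp, LinearEquiv.comp_symm, Submodule.map_id] }
  exact ⟨x, fun i => (x.transition_eq i).trans (hA i)⟩

end Rigidification

/-! ### Functors of points -/

section Functors

variable {N : ℕ} {r : ℕ} {d : Fin (N + 1) → ℕ}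

lemma isOpenSubfunctor_muOpen (r : ℕ) (d : Fin (N + 1) → ℕ) :
    IsOpenSubfunctor (muOpen.{u} r d) := by
  intro R x
  refine ⟨∏ i, minorIdeal (dim d - d i) (x.1 i), fun S f => ?_⟩
  have h : ∀ J : Fin (N + 1) → Ideal S, ∏ i, J i = ⊤ ↔ ∀ i, J i = ⊤ := fun J => by
    simp_rw [← Ideal.isUnit_iff]
    exact IsUnit.prod_univ_iff
  rw [show ∀ J : Fin (N + 1) → Ideal R, (∏ i, J i).map f.hom.toRingHom =
    ∏ i, (J i).map f.hom.toRingHom from fun J => map_prod (Ideal.mapHom f.hom.toRingHom) J _, h]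
  refine forall_congr' fun i => ?_
  rw [← minorIdeal_map]
  rfl

/-- The morphism `(ω_i, φ_i) ↦ (φ_{i-1} α_i φ_i⁻¹)`. -/
noncomputable def transitionHom (r : ℕ) (hN : 1 ≤ N) (hd : ∀ i, 0 < d i) :
    rigScheme.{u} r d ⟶ (muOpen.{u} r d).toFunctor where
  app R := ↾fun x : RigLocalModel r d R =>
    ⟨⟨x.transition, x.isMu_transition hN hd⟩, x.minorIdeal_transition⟩
  naturality R S f := by
    refine ConcreteCategory.hom_ext _ _ fun x => ?_
    exact Subtype.ext (Subtype.ext (funext fun i => RigLocalModel.transition_map f.hom x i))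

lemma transitionHom_ext {hN : 1 ≤ N} {hd : ∀ i, 0 < d i} {R : CommAlgCat.{u} ℤ[X]}
    {x : RigLocalModel r d R} {y : (muOpen.{u} r d).toFunctor.obj R}
    (h : ∀ i, x.transition i = y.1.1 i) : (transitionHom r hN hd).app R x = y :=
  Subtype.ext (Subtype.ext (funext h))

/-- The elements of `R` that are the product of the determinants of some `B i` satisfying the relation
of frames generate the unit ideal, and there is a section after inverting such an element. -/
lemma exists_local_section (hr : r ≤ dim d) (hN : 1 ≤ N) (hd : ∀ i, 0 < d i)
    {R : CommAlgCat.{u} ℤ[X]} (y : (muOpen.{u} r d).toFunctor.obj R) :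
    ∃ s : Set R, Ideal.span s = ⊤ ∧ ∀ f ∈ s,
      ∃ x : (rigScheme.{u} r d).obj (CommAlgCat.of ℤ[X] (Localization.Away f)),
        (transitionHom r hN hd).app _ x =
          (muOpen.{u} r d).toFunctor.map (toAway R f) y := by
  let A := y.1.1
  have hmu : IsMu r (dim d) N A := y.1.2
  have hA : ∀ i, cyclicProd A i (N + 1) = algebraMap ℤ[X] R Polynomial.X • 1 := fun i => by
    rw [← prod_ofFn_eq_cyclicProd]
    exact hmu.prod_eq i
  refine ⟨{f | ∃ B : Fin (N + 1) → Matrix (Fin (dim d)) (Fin (dim d)) R,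
    (∀ i, A i * B i = B (i - 1) * shiftPow R (dim d) (d i)) ∧ f = ∏ i, (B i).det}, ?_, ?_⟩
  · by_contra hne
    obtain ⟨I, hI, hle⟩ := Ideal.exists_le_maximal _ hne
    obtain ⟨B, hAB, hB⟩ := exists_frame hd A hA y.2 I
    obtain ⟨i, -, hi⟩ := (hI.isPrime.prod_mem_iff).1 (hle (Ideal.subset_span ⟨B, hAB, rfl⟩))
    exact hB i hi
  · rintro f ⟨B, hAB, hf⟩
    let g : R →ₐ[ℤ[X]] Localization.Away f := (toAway R f).hom
    have hAB' : ∀ i, (A i).map g * (B i).map g =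
        (B (i - 1)).map g * shiftPow (Localization.Away f) (dim d) (d i) := fun i => by
      have := congrArg (fun C => C.map g) (hAB i)
      simp only [Matrix.map_mul] at this
      rw [this, shiftPow_map]
    have hB' : ∀ i, IsUnit ((B i).map g).det := fun i => by
      have h : g f = algebraMap R (Localization.Away f) f := rfl
      have hunit : IsUnit (g f) := h ▸ IsLocalization.Away.algebraMap_isUnit f
      have hdvd : (B i).det ∣ f := hf ▸ Finset.dvd_prod_of_mem _ (Finset.mem_univ i)
      have := isUnit_of_dvd_unit (map_dvd g hdvd) hunit
      rwa [AlgHom.map_det] at this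
    obtain ⟨x, hx⟩ := exists_transition_eq_of_frame hr (hmu.map g).mem_lie hAB' hB'
    exact ⟨x, transitionHom_ext hx⟩

end Functors

end UnitaryLocalModel

theorem proposition2p2p4 (N : ℕ) (hN : 1 ≤ N) (d : Fin (N + 1) → ℕ) (hd : ∀ i, 0 < d i)
    (r : ℕ) (hr : r ≤ ∑ i, d i) :
    UnitaryLocalModel.IsOpenSubfunctor (UnitaryLocalModel.muOpen.{u} r d) ∧
    ∃ π : UnitaryLocalModel.rigScheme.{u} r d ⟶ (UnitaryLocalModel.muOpen.{u} r d).toFunctor,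
      (∀ (R : CommAlgCat.{u} ℤ[X]) (x : UnitaryLocalModel.RigLocalModel r d R) (i : Fin (N + 1)),
        (π.app R x).1.1 i = x.transition i) ∧
      UnitaryLocalModel.IsPrincipalHomogeneousSpace (UnitaryLocalModel.rigAction.{u} r d) π := by
  refine ⟨UnitaryLocalModel.isOpenSubfunctor_muOpen r d,
    UnitaryLocalModel.transitionHom r hN hd, fun _ _ _ => rfl, ⟨fun g x => ?_, fun x y h => ?_,
      fun y => UnitaryLocalModel.exists_local_section hr hN hd y⟩⟩
  · exact UnitaryLocalModel.transitionHom_ext fun i => x.transition_smul g i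
  · refine x.existsUnique_smul_eq y fun i => ?_
    exact congrArg (fun z => z.1.1 i) h
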